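/- **Setting.** Let $\alpha,\sigma:[0,1]\to\mathbb R$ be schedulers: continuous on $[0,1]$, differentiable on $(0,1)$, $\alpha$ strictly increasing from $\alpha_0=0$ to $\alpha_1=1$, $\sigma$ strictly decreasing from $\sigma_0=1$ to $\sigma_1=0$. Let $p_{\rm data}$ be any Borel probability measure on $\mathbb R^d$. Let $p_t$ be the law of $\alpha_t z+\sigma_t\epsilon$, where $z\sim p_{\rm data}$ and $\epsilon\sim\mathcal N(0,I_d)$ are independent; for $t<1$ write also $p_t(x)=\int\mathcal N(x;\alpha_tz,\sigma_t^2I_d)\,p_{\rm data}(\mathrm dz)$ for its density. For $0<t<1$ let $$p_{1|t}(\mathrm dz|x)=\frac{\mathcal N(x;\alpha_tz,\sigma_t^2I_d)\,p_{\rm data}(\mathrm dz)}{p_t(x)},\qquad D_t(x)=\int z\,p_{1|t}(\mathrm dz|x)$$ be the posterior and the denoiser. Let $g(t)=\sigma_t^2/\alpha_t^2$, a bijection $(0,1]\to[0,\infty)$, and set $$S_{s,t}(\bar x,x)=\frac{\alpha_s\sigma_t^2\bar x+\alpha_t\sigma_s^2x}{\sigma_t^2\alpha_s^2+\alpha_t^2\sigma_s^2},\qquad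 t^*(s,t)=g^{-1}\!\left(\frac{\sigma_t^2\sigma_s^2}{\sigma_t^2\alpha_s^2+\alpha_t^2\sigma_s^2}\right).$$ The GLASS posterior ODE for given $(x_t,t)$ is $$\frac{\mathrm d}{\mathrm ds}\bar x_s=\bar u_s(\bar x_s|x_t,t):=\frac{\dot\sigma_s}{\sigma_s}\bar x_s+\Big(\dot\alpha_s-\alpha_s\frac{\dot\sigma_s}{\sigma_s}\Big)D_{t^*}\big(\alpha_{t^*}S_{s,t}(\bar x_s,x_t)\big),\qquad t^*=t^*(s,t).$$ A trajectory on $[s,r]$ is a function that is continuous on $[s,r]$ and solves the ODE on $(s,r)$. The Posterior Diamond Map $X_{s,r}(\cdot|x_t,t)$ is the flow map of this ODE: it sends $\bar x$ to the value at time $r$ of the trajectory on $[s,r]$ that starts at $\bar x$ at time $s$ (and, by convention, to $0$ if there is none). For $t<t'$ let $$q_{t|t'}(x_t|x_{t'})=\mathcal N\Big(x_t;\tfrac{\alpha_t}{\alpha_{t'}}x_{t'},\big(\sigma_t^2-\tfrac{\alpha_t^2}{\alpha_{t'}^2}\sigma_{t'}^2\big)I_d\Big),\qquad p^{\rm DDPM}_{t'|t}(\mathrm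 dx_{t'}|x_t)=\frac{q_{t|t'}(x_t|x_{t'})\,p_{t'}(\mathrm dx_{t'})}{p_t(x_t)}$$ be the forward noising kernel and the DDPM (time-reversal) transition kernel. **Proposition (Diamond DDPM sampling).** Let $0<t<t'\le1$, $x_t\in\mathbb R^d$ and $r^*=g^{-1}\big(g(t)g(t')/(g(t)-g(t'))\big)$. Then: 1. The argument of $g^{-1}$ in the definition of $r^*$ lies in $[0,\infty)$, so $r^*\in(0,1]$ is well defined, and $t^*(r^*,t)=t'$. 2. The flow map is well defined: for $0\le s\le r\le1$, every trajectory $y$ on $[s,r]$ satisfies $X_{s,r}(y_s|x_t,t)=y_r$. If $t'<1$, a trajectory on $[0,r^*]$ starts from every point $\bar x_0\in\mathbb R^d$; if $t'=1$, one starts from $\mathcal N(0,I_d)$-almost every $\bar x_0$. 3. If $\bar x_0\sim\mathcal N(0,I_d)$, $\bar x_{r^*}=X_{0,r^*}(\bar x_0|x_t,t)$ and $x_{t'}=\alpha_{t'}S_{r^*,t}(\bar x_{r^*},x_t)$, then $$x_{t'}\sim p^{\rm DDPM}_{t'|t}(\cdot|x_t).$$ -/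

import Mathlib

open MeasureTheory ProbabilityTheory Set
open scoped ENNReal

namespace DiamondMap

noncomputable section

/-- Points of `ℝ^d`, with the Euclidean norm. -/
abbrev Pt (d : ℕ) : Type := EuclideanSpace ℝ (Fin d)

/-- `α`, `σ` are schedulers on `[0,1]`: continuous on `[0,1]`, differentiable on `(0,1)`,
`α` strictly increasing from `0` to `1` and `σ` strictly decreasing from `1` to `0`. -/
structure IsScheduler (α σ : ℝ → ℝ) : Prop where
  continuousOn_α : ContinuousOn α (Icc 0 1)
  continuousOn_σ : ContinuousOn σ (Icc 0 1)
  differentiableOn_α : DifferentiableOn ℝ α (Ioo 0 1)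
  differentiableOn_σ : DifferentiableOn ℝ σ (Ioo 0 1)
  strictMonoOn_α : StrictMonoOn α (Icc 0 1)
  strictAntiOn_σ : StrictAntiOn σ (Icc 0 1)
  α_zero : α 0 = 0
  α_one : α 1 = 1
  σ_zero : σ 0 = 1
  σ_one : σ 1 = 0

/-- The density at `x` of the Gaussian law `𝒩(m, v I_d)`, for `v > 0`. -/
def gaussianDensity {d : ℕ} (m : Pt d) (v : ℝ) (x : Pt d) : ℝ :=
  (√(2 * Real.pi * v) ^ d)⁻¹ * Real.exp (-‖x - m‖ ^ 2 / (2 * v))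

/-- The marginal law `p_t` of `α_t z + σ_t ε`, where `z ∼ p_data` and `ε ∼ 𝒩(0, I_d)` are
independent. -/
def marginal {d : ℕ} (α σ : ℝ → ℝ) (pdata : Measure (Pt d)) (t : ℝ) : Measure (Pt d) :=
  (pdata.prod (stdGaussian (Pt d))).map (fun p => α t • p.1 + σ t • p.2)

/-- The marginal density `p_t(x) = 𝔼_{z ∼ p_data} [𝒩(x; α_t z, σ_t² I_d)]`, for `σ_t > 0`. -/
def marginalDensity {d : ℕ} (α σ : ℝ → ℝ) (pdata : Measure (Pt d)) (t : ℝ) (x : Pt d) : ℝ :=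
  ∫ z, gaussianDensity (α t • z) (σ t ^ 2) x ∂pdata

/-- The posterior `p_{1|t}(dz | x) = 𝒩(x; α_t z, σ_t² I_d) p_data(dz) / p_t(x)`. -/
def posterior {d : ℕ} (α σ : ℝ → ℝ) (pdata : Measure (Pt d)) (t : ℝ) (x : Pt d) :
    Measure (Pt d) :=
  pdata.withDensity fun z =>
    ENNReal.ofReal (gaussianDensity (α t • z) (σ t ^ 2) x / marginalDensity α σ pdata t x)

/-- The denoiser `D_t(x) = ∫ z p_{1|t}(dz | x)`. -/
def denoiser {d : ℕ} (α σ : ℝ → ℝ) (pdata : Measure (Pt d)) (t : ℝ) (x : Pt d) : Pt d :=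
  ∫ z, z ∂(posterior α σ pdata t x)

/-- `g(t) = σ_t² / α_t²`. -/
def g (α σ : ℝ → ℝ) (t : ℝ) : ℝ := σ t ^ 2 / α t ^ 2

/-- The inverse of the bijection `g : (0,1] → [0,∞)`. -/
def gInv (α σ : ℝ → ℝ) (y : ℝ) : ℝ := Function.invFunOn (g α σ) (Ioc 0 1) y

/-- The sufficient statistic `S_{s,t}(x̄, x)`. -/
def suffStat {d : ℕ} (α σ : ℝ → ℝ) (s t : ℝ) (xbar x : Pt d) : Pt d :=
  (σ t ^ 2 * α s ^ 2 + α t ^ 2 * σ s ^ 2)⁻¹ •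
    ((α s * σ t ^ 2) • xbar + (α t * σ s ^ 2) • x)

/-- The time reparameterization `t*(s,t)`. -/
def tStar (α σ : ℝ → ℝ) (s t : ℝ) : ℝ :=
  gInv α σ (σ t ^ 2 * σ s ^ 2 / (σ t ^ 2 * α s ^ 2 + α t ^ 2 * σ s ^ 2))

/-- The GLASS velocity field of the posterior,
`ū_s(x̄ | x, t) = (σ̇_s/σ_s) x̄ + (α̇_s - α_s σ̇_s/σ_s) D_{t*}(α_{t*} S_{s,t}(x̄, x))`. -/
def glassField {d : ℕ} (α σ : ℝ → ℝ) (pdata : Measure (Pt d)) (t : ℝ) (x : Pt d)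
    (s : ℝ) (xbar : Pt d) : Pt d :=
  (deriv σ s / σ s) • xbar +
    (deriv α s - α s * (deriv σ s / σ s)) •
      denoiser α σ pdata (tStar α σ s t) (α (tStar α σ s t) • suffStat α σ s t xbar x)

/-- `y` is a trajectory on the inner time interval `[s, r]` of the GLASS posterior ODE
`dy/du = ū_u(y_u | x, t)`: continuous on `[s, r]` and solving the equation on `(s, r)`.
(The coefficients of the equation may be singular at the times `0` and `1`.) -/
def IsGlassTrajectory {d : ℕ} (α σ : ℝ → ℝ) (pdata : Measure (Pt d)) (t : ℝ) (x : Pt d)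
    (s r : ℝ) (y : ℝ → Pt d) : Prop :=
  ContinuousOn y (Icc s r) ∧
    ∀ u ∈ Ioo s r, HasDerivAt y (glassField α σ pdata t x u (y u)) u

open Classical in
/-- The exact Posterior Diamond Map `X_{s,r}(x̄ | x, t)`: the flow map of the GLASS posterior ODE,
that is, the value at time `r` of the trajectory on `[s, r]` that starts at `x̄` at time `s`
(and `0` at points from which no trajectory starts). -/
def diamondMap {d : ℕ} (α σ : ℝ → ℝ) (pdata : Measure (Pt d)) (t : ℝ) (x : Pt d)
    (s r : ℝ) (xbar : Pt d) : Pt d :=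
  if h : ∃ y : ℝ → Pt d, IsGlassTrajectory α σ pdata t x s r y ∧ y s = xbar
  then h.choose r else 0

/-- The inner stopping time `r* = g⁻¹(g(t) g(t') / (g(t) - g(t')))`. -/
def rStar (α σ : ℝ → ℝ) (t t' : ℝ) : ℝ :=
  gInv α σ (g α σ t * g α σ t' / (g α σ t - g α σ t'))

/-- The result `x_{t'} = α_{t'} S_{r*,t}(X_{0,r*}(x̄₀ | x, t), x)` of Diamond DDPM sampling, as a
function of the initial inner noise `x̄₀`. -/
def diamondSample {d : ℕ} (α σ : ℝ → ℝ) (pdata : Measure (Pt d)) (t t' : ℝ) (x : Pt d)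
    (xbar₀ : Pt d) : Pt d :=
  α t' • suffStat α σ (rStar α σ t t') t
    (diamondMap α σ pdata t x 0 (rStar α σ t t') xbar₀) x

/-- The density `q_{t|t'}(x | x')` of the forward noising kernel from time `t'` to time `t < t'`,
`𝒩(x; (α_t/α_{t'}) x', (σ_t² - (α_t²/α_{t'}²) σ_{t'}²) I_d)`. -/
def forwardDensity {d : ℕ} (α σ : ℝ → ℝ) (t t' : ℝ) (x x' : Pt d) : ℝ :=
  gaussianDensity ((α t / α t') • x') (σ t ^ 2 - α t ^ 2 / α t' ^ 2 * σ t' ^ 2) x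

/-- The DDPM transition kernel
`p^DDPM_{t'|t}(dx' | x) = q_{t|t'}(x | x') p_{t'}(dx') / p_t(x)`. -/
def ddpmKernel {d : ℕ} (α σ : ℝ → ℝ) (pdata : Measure (Pt d)) (t t' : ℝ) (x : Pt d) :
    Measure (Pt d) :=
  (marginal α σ pdata t').withDensity fun x' =>
    ENNReal.ofReal (forwardDensity α σ t t' x x' / marginalDensity α σ pdata t x)

end

end DiamondMap

/-!
In the variables `w = x̄ / σ_s` and `u = α_s / σ_s` the GLASS posterior ODE loses its singular linear
term. The sufficient statistic and the time `t*` are made so that the denoiser in it is the mean of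
`p_data` under a Gaussian weight whose exponent is the sum of those of the two observations
`(x̄, s)` and `(x, t)`. So the equation becomes `dw/du = f(u, w)`, where `f(u, w)` is the conditional
mean of `z` given `u z + ε = w`, for `z` distributed as the posterior `ν = p_{1|t}(· | x)` and `ε` a
standard Gaussian independent of `z` (`IsScheduler.glassField_eq`, `isPosteriorMean_glassDrift`).

Unlike `p_data`, the posterior has a Gaussian factor `exp (-a₀ ‖z‖² / 2)` with `a₀ > 0`. This makes
`f` locally Lipschitz and of linear growth (`isTameField_tiltField`), with no assumption on the
moments of `p_data`, so that its flow `Φ` exists for all times `u`. Uniqueness of trajectories is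
Grönwall's inequality in the time `u`.

The flow from time `0` to time `T` carries the law of `ε` to the law of `T z + ε`
(`map_flow_stdGaussian`). Usually this is read off from the continuity equation. Here it is proved
along test functions: if `ψ_τ(w)` is the value of a Lipschitz function `φ` at the end of the curve
that starts from `w` at time `τ`, then `𝔼 ψ_τ(τ z + ε)` does not depend on `τ`. A step back in time
changes it, to first order, by the mean of `Dψ_τ(τ z + ε) (f(τ, τ z + ε) - z)`, which is zero since
`f` is the conditional mean of `z`. By Rademacher's theorem `ψ_τ` is differentiable where this is
needed.

If `t' < 1`, then `r* < 1` corresponds to a finite time `T`, at which `T² = (α/σ)²(t') - (α/σ)²(t)`.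
Hence the sample `x_{t'}` has the law of an affine function of `T z + ε`. That this is the DDPM
kernel is Bayes' rule for Gaussian densities (`gaussianDensity_mul_gaussianDensity`,
`ddpmKernel_eq_map`).

If `t' = 1`, then `r* = 1` corresponds to `u = ∞`, the DDPM kernel is `ν`, and a trajectory has an
end point if and only if `Φ_u(w) / u` converges as `u → ∞`. Since `Φ_u(w)` has the law of `u z + ε`,
Jensen's inequality bounds the expected speed `𝔼 ‖f - Φ_u / u‖ / u` of this quotient by
`𝔼 ‖ε‖ / u²`, which is integrable at infinity. So the limit exists for almost every `w`
(`ae_exists_tendsto_flow_div`), and its law is the limit `ν` of the laws of `z + ε / u`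
(`map_lim_flow_div`).
-/

set_option linter.unusedSectionVars false

namespace DiamondMap

open Filter
open scoped NNReal Topology

/-! ### Integral curves and flows of time-dependent vector fields -/

section ODE

variable {E : Type*} [NormedAddCommGroup E] [NormedSpace ℝ E]

/-- Grönwall's inequality for a differentiable curve, in both time directions. -/
lemma norm_le_gronwallBound_abs {D D' : ℝ → E} {K ε a b : ℝ}
    (hD : ∀ u ∈ uIcc a b, HasDerivAt D (D' u) u)
    (bound : ∀ u ∈ uIcc a b, ‖D' u‖ ≤ K * ‖D u‖ + ε) :
    ‖D b‖ ≤ gronwallBound ‖D a‖ K ε |b - a| := by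
  rcases le_total a b with hab | hab
  · rw [uIcc_of_le hab] at hD bound
    rw [abs_of_nonneg (sub_nonneg.2 hab)]
    exact norm_le_gronwallBound_of_norm_deriv_right_le
      (fun u hu => (hD u hu).continuousAt.continuousWithinAt)
      (fun u hu => (hD u (Ico_subset_Icc_self hu)).hasDerivWithinAt) le_rfl
      (fun u hu => bound u (Ico_subset_Icc_self hu)) b (right_mem_Icc.2 hab)
  · rw [uIcc_of_ge hab] at hD bound
    have hm : ∀ u ∈ Icc (-a) (-b), -u ∈ Icc b a := fun u hu =>
      ⟨by linarith [hu.2], by linarith [hu.1]⟩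
    have hD' : ∀ u ∈ Icc (-a) (-b), HasDerivAt (fun v => D (-v)) (-D' (-u)) u := fun u hu => by
      simpa [Function.comp_def] using (hD (-u) (hm u hu)).scomp u (hasDerivAt_neg u)
    have := norm_le_gronwallBound_of_norm_deriv_right_le (f := fun v => D (-v))
      (f' := fun v => -D' (-v)) (δ := ‖D a‖) (K := K) (ε := ε) (a := -a) (b := -b)
      (fun u hu => (hD' u hu).continuousAt.continuousWithinAt)
      (fun u hu => (hD' u (Ico_subset_Icc_self hu)).hasDerivWithinAt) (by simp)
      (fun u hu => by simpa using bound (-u) (hm u (Ico_subset_Icc_self hu)))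
      (-b) (right_mem_Icc.2 (by linarith))
    rw [abs_of_nonpos (sub_nonpos.2 hab)]
    convert this using 2 <;> simp
    ring

/-- A time-dependent vector field whose integral curves form a complete continuous flow: it is
Lipschitz in space and time on bounded sets, and of linear growth in space, locally uniformly in
time. -/
structure IsTameField (f : ℝ → E → E) : Prop where
  lipschitz : ∀ N R : ℝ, ∃ K : ℝ, 0 ≤ K ∧ ∀ u v w z, |u| ≤ N → |v| ≤ N → ‖w‖ ≤ R → ‖z‖ ≤ R →
    ‖f u w - f v z‖ ≤ K * (|u - v| + ‖w - z‖)
  growth : ∀ N : ℝ, ∃ C : ℝ, 0 < C ∧ ∀ u w, |u| ≤ N → ‖f u w‖ ≤ C * (1 + ‖w‖)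

/-- A time-dependent vector field that is bounded by `B`, and `K`-Lipschitz in space and time. -/
structure IsBoundedLipschitzField (f : ℝ → E → E) (K B : ℝ) : Prop where
  nonneg_K : 0 ≤ K
  nonneg_B : 0 ≤ B
  lipschitz : ∀ u v w z, ‖f u w - f v z‖ ≤ K * (|u - v| + ‖w - z‖)
  bound : ∀ u w, ‖f u w‖ ≤ B

lemma IsBoundedLipschitzField.isTameField {f : ℝ → E → E} {K B : ℝ}
    (hf : IsBoundedLipschitzField f K B) : IsTameField f where
  lipschitz _ _ := ⟨K, hf.nonneg_K, fun u v w z _ _ _ _ => hf.lipschitz u v w z⟩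
  growth _ := ⟨B + 1, by linarith [hf.nonneg_B], fun u w _ => by
    nlinarith [hf.bound u w, norm_nonneg w, hf.nonneg_B, mul_nonneg hf.nonneg_B (norm_nonneg w)]⟩

lemma IsBoundedLipschitzField.continuous {f : ℝ → E → E} {K B : ℝ}
    (hf : IsBoundedLipschitzField f K B) : Continuous (Function.uncurry f) := by
  refine (LipschitzWith.of_dist_le_mul (K := (K * 2).toNNReal) fun p q => ?_).continuous
  rw [Real.coe_toNNReal _ (by linarith [hf.nonneg_K]), dist_eq_norm]
  refine (hf.lipschitz p.1 q.1 p.2 q.2).trans ?_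
  have h1 : |p.1 - q.1| ≤ dist p q := by rw [← Real.dist_eq]; exact le_max_left _ _
  have h2 : ‖p.2 - q.2‖ ≤ dist p q := by rw [← dist_eq_norm]; exact le_max_right _ _
  nlinarith [hf.nonneg_K]

/-- The radial retraction onto the closed ball of radius `R > 0`. -/
noncomputable def radialRetraction (R : ℝ) (w : E) : E := (R / max R ‖w‖) • w

lemma norm_radialRetraction_le {R : ℝ} (hR : 0 < R) (w : E) : ‖radialRetraction R w‖ ≤ R := by
  have h : 0 < max R ‖w‖ := lt_max_of_lt_left hR
  rw [radialRetraction, norm_smul, Real.norm_of_nonneg (by positivity), div_mul_eq_mul_div,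
    div_le_iff₀ h]
  exact mul_le_mul_of_nonneg_left (le_max_right _ _) hR.le

lemma norm_radialRetraction_le_norm {R : ℝ} (hR : 0 < R) (w : E) :
    ‖radialRetraction R w‖ ≤ ‖w‖ := by
  have h : 0 < max R ‖w‖ := lt_max_of_lt_left hR
  rw [radialRetraction, norm_smul, Real.norm_of_nonneg (by positivity)]
  exact mul_le_of_le_one_left (norm_nonneg _) ((div_le_one h).2 (le_max_left _ _))

lemma radialRetraction_of_norm_le {R : ℝ} (hR : 0 < R) {w : E} (hw : ‖w‖ ≤ R) :
    radialRetraction R w = w := by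
  rw [radialRetraction, max_eq_left hw, div_self hR.ne', one_smul]

lemma norm_radialRetraction_sub_le {R : ℝ} (hR : 0 < R) (x y : E) :
    ‖radialRetraction R x - radialRetraction R y‖ ≤ 2 * ‖x - y‖ := by
  have ha : 0 < max R ‖x‖ := lt_max_of_lt_left hR
  have hb : 0 < max R ‖y‖ := lt_max_of_lt_left hR
  have key : radialRetraction R x - radialRetraction R y =
      (R / max R ‖x‖) • (x - y) + (R / max R ‖x‖ - R / max R ‖y‖) • y := by
    simp only [radialRetraction]; module
  have h1 : R / max R ‖x‖ ≤ 1 := (div_le_one ha).2 (le_max_left _ _)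
  have h2 : |max R ‖y‖ - max R ‖x‖| ≤ ‖x - y‖ :=
    (abs_max_sub_max_le_max _ _ _ _).trans (max_le (by simp)
      (norm_sub_rev x y ▸ abs_norm_sub_norm_le y x))
  have h3 : |R / max R ‖x‖ - R / max R ‖y‖| * ‖y‖ ≤ ‖x - y‖ := by
    have : R / max R ‖x‖ - R / max R ‖y‖ =
        (R / max R ‖x‖) * ((max R ‖y‖ - max R ‖x‖) / max R ‖y‖) := by
      field_simp
    rw [this, abs_mul, abs_of_pos (div_pos hR ha), abs_div, abs_of_pos hb]
    calc R / max R ‖x‖ * (|max R ‖y‖ - max R ‖x‖| / max R ‖y‖) * ‖y‖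
        = R / max R ‖x‖ * (|max R ‖y‖ - max R ‖x‖| * (‖y‖ / max R ‖y‖)) := by ring
      _ ≤ 1 * (|max R ‖y‖ - max R ‖x‖| * 1) := by
          gcongr
          exact (div_le_one hb).2 (le_max_right _ _)
      _ ≤ ‖x - y‖ := by simpa using h2
  rw [key]
  refine (norm_add_le _ _).trans ?_
  rw [norm_smul, norm_smul, Real.norm_of_nonneg (div_pos hR ha).le, Real.norm_eq_abs]
  nlinarith [norm_nonneg (x - y)]

/-- A tame field agrees on any given bounded set with a bounded Lipschitz field whose linear growth
bound does not depend on the set of positions. -/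
lemma IsTameField.exists_truncation {f : ℝ → E → E} (hf : IsTameField f) (N : ℝ) (hN : 0 ≤ N) :
    ∃ C : ℝ, 0 < C ∧ ∀ R : ℝ, ∃ (h : ℝ → E → E) (K B : ℝ), IsBoundedLipschitzField h K B ∧
      (∀ u w, ‖h u w‖ ≤ C * (1 + ‖w‖)) ∧
      ∀ u w, |u| ≤ N → ‖w‖ ≤ R → h u w = f u w := by
  obtain ⟨C, hC, hg⟩ := hf.growth N
  refine ⟨C, hC, fun R₀ => ?_⟩
  obtain ⟨R, hR0, hR⟩ : ∃ R : ℝ, R₀ ≤ R ∧ 0 < R := ⟨max R₀ 1, le_max_left _ _, by positivity⟩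
  obtain ⟨K, hK, hl⟩ := hf.lipschitz N R
  have hc : ∀ u : ℝ, |max (-N) (min N u)| ≤ N := fun u =>
    abs_le.2 ⟨le_max_left _ _, max_le (by linarith) (min_le_left _ _)⟩
  have hcl : ∀ u v : ℝ, |max (-N) (min N u) - max (-N) (min N v)| ≤ |u - v| := fun u v =>
    (abs_max_sub_max_le_max _ _ _ _).trans (max_le (by simp)
      ((abs_min_sub_min_le_max _ _ _ _).trans (max_le (by simp) le_rfl)))
  refine ⟨fun u w => f (max (-N) (min N u)) (radialRetraction R w), K * 2, C * (1 + R),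
    ⟨by positivity, by positivity, fun u v w z => ?_, fun u w => ?_⟩, fun u w => ?_,
    fun u w hu hw => ?_⟩
  · refine (hl _ _ _ _ (hc u) (hc v) (norm_radialRetraction_le hR w)
      (norm_radialRetraction_le hR z)).trans ?_
    rw [mul_assoc]
    refine mul_le_mul_of_nonneg_left ?_ hK
    linarith [hcl u v, norm_radialRetraction_sub_le hR w z, abs_nonneg (u - v)]
  · refine (hg _ _ (hc u)).trans ?_
    gcongr
    exact norm_radialRetraction_le hR w
  · refine (hg _ _ (hc u)).trans ?_
    gcongr
    exact norm_radialRetraction_le_norm hR w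
  · have hu' := abs_le.1 hu
    simp only [radialRetraction_of_norm_le hR (hw.trans hR0), min_eq_right hu'.2,
      max_eq_right hu'.1]

/-- Linear growth of the field bounds its curves, in both time directions. -/
lemma norm_curve_le {f : ℝ → E → E} {W : ℝ → E} {C a b : ℝ} (hC : 0 < C)
    (hW : ∀ u ∈ uIcc a b, HasDerivAt W (f u (W u)) u)
    (hf : ∀ u ∈ uIcc a b, ∀ w, ‖f u w‖ ≤ C * (1 + ‖w‖)) :
    ‖W b‖ ≤ (1 + ‖W a‖) * Real.exp (C * |b - a|) := by
  have := norm_le_gronwallBound_abs (K := C) (ε := C) hW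
    (fun u hu => by linarith [hf u hu (W u)])
  rw [gronwallBound_of_K_ne_0 hC.ne', div_self hC.ne'] at this
  linarith

/-- Curves of a field that is `K`-Lipschitz where they run diverge at most exponentially, in both
time directions. -/
lemma norm_curve_sub_le {f : ℝ → E → E} {V W : ℝ → E} {K a b : ℝ}
    (hV : ∀ u ∈ uIcc a b, HasDerivAt V (f u (V u)) u)
    (hW : ∀ u ∈ uIcc a b, HasDerivAt W (f u (W u)) u)
    (hf : ∀ u ∈ uIcc a b, ‖f u (V u) - f u (W u)‖ ≤ K * ‖V u - W u‖) :
    ‖V b - W b‖ ≤ ‖V a - W a‖ * Real.exp (K * |b - a|) := by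
  have := norm_le_gronwallBound_abs (D := fun u => V u - W u) (K := K) (ε := 0)
    (fun u hu => (hV u hu).sub (hW u hu)) (fun u hu => by simpa using hf u hu)
  simpa [gronwallBound_ε0] using this

lemma IsTameField.curve_unique_uIcc {f : ℝ → E → E} (hf : IsTameField f) {V W : ℝ → E} {a b : ℝ}
    (hV : ∀ u ∈ uIcc a b, HasDerivAt V (f u (V u)) u)
    (hW : ∀ u ∈ uIcc a b, HasDerivAt W (f u (W u)) u) (hab : V a = W a) : V b = W b := by
  have hcV : ContinuousOn V (uIcc a b) := fun u hu => (hV u hu).continuousAt.continuousWithinAt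
  have hcW : ContinuousOn W (uIcc a b) := fun u hu => (hW u hu).continuousAt.continuousWithinAt
  obtain ⟨R₁, hR₁⟩ := isCompact_uIcc.exists_bound_of_continuousOn hcV
  obtain ⟨R₂, hR₂⟩ := isCompact_uIcc.exists_bound_of_continuousOn hcW
  obtain ⟨N, hN⟩ := isCompact_uIcc.exists_bound_of_continuousOn (continuousOn_id (s := uIcc a b))
  obtain ⟨K, hK, hl⟩ := hf.lipschitz N (max R₁ R₂)
  have := norm_curve_sub_le hV hW (K := K) fun u hu => by
    simpa using hl u u (V u) (W u) (hN u hu) (hN u hu) ((hR₁ u hu).trans (le_max_left _ _))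
      ((hR₂ u hu).trans (le_max_right _ _))
  rw [hab, sub_self, norm_zero, zero_mul] at this
  exact sub_eq_zero.1 (norm_le_zero_iff.1 this)

lemma IsTameField.curve_unique {f : ℝ → E → E} (hf : IsTameField f) {V W : ℝ → E} {a : ℝ}
    (hV : IsIntegralCurve V f) (hW : IsIntegralCurve W f) (ha : V a = W a) : V = W :=
  funext fun b => hf.curve_unique_uIcc (a := a) (b := b) (fun u _ => hV u) (fun u _ => hW u) ha

variable [CompleteSpace E]

lemma IsBoundedLipschitzField.exists_curve {f : ℝ → E → E} {K B : ℝ}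
    (hf : IsBoundedLipschitzField f K B) (a : ℝ) (w : E) {n : ℝ} (hn : 0 ≤ n) :
    ∃ W : ℝ → E, W a = w ∧ ∀ u ∈ Ioo (a - n) (a + n), HasDerivAt W (f u (W u)) u := by
  have hB := hf.nonneg_B
  have hPL : IsPicardLindelof f (tmin := a - n) (tmax := a + n) ⟨a, by simp [hn]⟩ w
      (B * n).toNNReal 0 B.toNNReal K.toNNReal := by
    refine ⟨fun u _ => ?_, fun z _ => ?_, fun u _ z _ => ?_, ?_⟩
    · refine LipschitzWith.lipschitzOnWith (LipschitzWith.of_dist_le_mul fun x y => ?_)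
      rw [Real.coe_toNNReal _ hf.nonneg_K, dist_eq_norm, dist_eq_norm]
      simpa using hf.lipschitz u u x y
    · exact (hf.continuous.comp (Continuous.prodMk_left z)).continuousOn
    · rw [Real.coe_toNNReal _ hB]; exact hf.bound u z
    · rw [Real.coe_toNNReal _ hB, Real.coe_toNNReal _ (by positivity)]; simp
  obtain ⟨W, hW0, hW⟩ := hPL.exists_eq_forall_mem_Icc_hasDerivWithinAt₀
  exact ⟨W, hW0, fun u hu => (hW u (Ioo_subset_Icc_self hu)).hasDerivAt (Icc_mem_nhds hu.1 hu.2)⟩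

/-- Through every point runs a curve of a tame field, defined for all times. -/
lemma IsTameField.exists_curve {f : ℝ → E → E} (hf : IsTameField f) (a : ℝ) (w : E) :
    ∃ W : ℝ → E, W a = w ∧ IsIntegralCurve W f := by
  have hloc : ∀ n : ℕ, ∃ W : ℝ → E, W a = w ∧
      ∀ u ∈ Ioo (a - n) (a + n), HasDerivAt W (f u (W u)) u := fun n => by
    obtain ⟨C, hC, hh⟩ := hf.exists_truncation (|a| + n) (by positivity)
    -- by the growth bound, curves from `w` stay in this ball up to time `n`
    obtain ⟨h, K, B, hBL, hg, heq⟩ := hh ((1 + ‖w‖) * Real.exp (C * n))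
    obtain ⟨W, hW0, hW⟩ := hBL.exists_curve a w (n := n) (by positivity)
    refine ⟨W, hW0, fun u hu => ?_⟩
    have hua : |u - a| ≤ n := abs_le.2 ⟨by linarith [hu.1], by linarith [hu.2]⟩
    have hsub : uIcc a u ⊆ Ioo (a - n) (a + n) := by
      have hn : (0 : ℝ) < n := by linarith [hu.1, hu.2]
      exact ordConnected_Ioo.uIcc_subset ⟨by linarith, by linarith⟩ hu
    rw [← heq u (W u)]
    · exact hW u hu
    · have := abs_add_le a (u - a)
      rw [add_sub_cancel] at this
      linarith
    · refine (norm_curve_le hC (fun v hv => hW v (hsub hv)) fun v _ => hg v).trans ?_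
      rw [hW0]
      gcongr
  choose V hV0 hV using hloc
  have hagree : ∀ (n m : ℕ) (u : ℝ), |u - a| < n → |u - a| < m → V n u = V m u := by
    intro n m u hn hm
    have hsub : ∀ k : ℕ, |u - a| < k → uIcc a u ⊆ Ioo (a - k) (a + k) := fun k hk => by
      rw [abs_lt] at hk
      have hk0 : (0 : ℝ) < k := by linarith [hk.1, hk.2]
      exact ordConnected_Ioo.uIcc_subset ⟨by linarith, by linarith⟩
        ⟨by linarith [hk.1], by linarith [hk.2]⟩
    exact hf.curve_unique_uIcc (a := a) (b := u) (fun v hv => hV n v (hsub n hn hv))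
      (fun v hv => hV m v (hsub m hm hv)) ((hV0 n).trans (hV0 m).symm)
  have hlt : ∀ u : ℝ, |u - a| < (⌊|u - a|⌋₊ + 1 : ℕ) := fun u => by
    exact_mod_cast Nat.lt_floor_add_one |u - a|
  refine ⟨fun u => V (⌊|u - a|⌋₊ + 1) u, hV0 _, fun u => ?_⟩
  have hu := hlt u
  refine (hV (⌊|u - a|⌋₊ + 1) u ?_).congr_of_eventuallyEq ?_
  · rw [abs_lt] at hu
    exact ⟨by linarith [hu.1], by linarith [hu.2]⟩
  · have hc : ContinuousAt (fun v : ℝ => |v - a|) u := by fun_prop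
    filter_upwards [hc.eventually_lt_const hu] with v hv
    exact hagree _ _ v (hlt v) hv

/-- The flow of a tame field `f`: the position at time `u` of the curve that passes through `w` at
time `a`. -/
noncomputable def flow {f : ℝ → E → E} (hf : IsTameField f) (a : ℝ) (w : E) (u : ℝ) : E :=
  (hf.exists_curve a w).choose u

section flow

variable {f : ℝ → E → E} (hf : IsTameField f)

lemma flow_self (a : ℝ) (w : E) : flow hf a w a = w := (hf.exists_curve a w).choose_spec.1

lemma isIntegralCurve_flow (a : ℝ) (w : E) : IsIntegralCurve (flow hf a w) f :=
  (hf.exists_curve a w).choose_spec.2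

lemma flow_flow (a b : ℝ) (w : E) : flow hf b (flow hf a w b) = flow hf a w :=
  hf.curve_unique (a := b) (isIntegralCurve_flow hf _ _) (isIntegralCurve_flow hf _ _)
    (flow_self hf _ _)

lemma continuous_flow_time (a : ℝ) (w : E) : Continuous (flow hf a w) :=
  (isIntegralCurve_flow hf a w).continuous

lemma continuous_flow_space (a b : ℝ) : Continuous fun w => flow hf a w b := by
  obtain ⟨N, hN⟩ := isCompact_uIcc.exists_bound_of_continuousOn (continuousOn_id (s := uIcc a b))
  obtain ⟨C, hC, hg⟩ := hf.growth N
  refine continuous_iff_continuousAt.2 fun w₀ => ?_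
  -- curves that start within distance `1` of `w₀` stay in a common ball
  obtain ⟨K, hK, hl⟩ := hf.lipschitz N ((2 + ‖w₀‖) * Real.exp (C * |b - a|))
  have hstay : ∀ w, ‖w - w₀‖ ≤ 1 → ∀ u ∈ uIcc a b,
      ‖flow hf a w u‖ ≤ (2 + ‖w₀‖) * Real.exp (C * |b - a|) := fun w hw u hu => by
    refine (norm_curve_le hC (fun v _ => isIntegralCurve_flow hf a w v) fun v hv z =>
      hg v z (hN v (uIcc_subset_uIcc_left hu hv))).trans ?_
    rw [flow_self]
    have h1 : ‖w‖ ≤ 1 + ‖w₀‖ := by linarith [norm_le_norm_add_norm_sub' w w₀]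
    have h2 := abs_sub_left_of_mem_uIcc hu
    refine mul_le_mul (by linarith) ?_ (by positivity) (by positivity)
    gcongr
  have hle : ∀ w, ‖w - w₀‖ ≤ 1 →
      ‖flow hf a w b - flow hf a w₀ b‖ ≤ ‖w - w₀‖ * Real.exp (K * |b - a|) := fun w hw => by
    have := norm_curve_sub_le (K := K) (a := a) (b := b)
      (fun v _ => isIntegralCurve_flow hf a w v)
      (fun v _ => isIntegralCurve_flow hf a w₀ v) fun u hu => by
        simpa using hl u u _ _ (hN u hu) (hN u hu) (hstay w hw u hu) (hstay w₀ (by simp) u hu)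
    rwa [flow_self, flow_self] at this
  rw [ContinuousAt, tendsto_iff_norm_sub_tendsto_zero]
  have hlim : Tendsto (fun w => ‖w - w₀‖ * Real.exp (K * |b - a|)) (𝓝 w₀) (𝓝 0) := by
    have : Continuous fun w => ‖w - w₀‖ * Real.exp (K * |b - a|) := by fun_prop
    simpa using this.tendsto w₀
  refine squeeze_zero' (Eventually.of_forall fun _ => norm_nonneg _) ?_ hlim
  filter_upwards [Metric.closedBall_mem_nhds w₀ one_pos] with w hw
  exact hle w (by simpa [dist_eq_norm] using hw)

lemma norm_flow_sub_le {K B : ℝ} (hBL : IsBoundedLipschitzField f K B) (a b : ℝ) (w z : E) :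
    ‖flow hf a w b - flow hf a z b‖ ≤ ‖w - z‖ * Real.exp (K * |b - a|) := by
  have := norm_curve_sub_le (K := K) (a := a) (b := b) (fun v _ => isIntegralCurve_flow hf a w v)
      (fun v _ => isIntegralCurve_flow hf a z v) fun u _ => by
        simpa using hBL.lipschitz u u (flow hf a w u) (flow hf a z u)
  rwa [flow_self, flow_self] at this

end flow

end ODE

/-! ### Gaussian exponential weights and the means they define -/

section Tilt

open scoped RealInnerProductSpace

variable {E : Type*} [NormedAddCommGroup E] [InnerProductSpace ℝ E] [FiniteDimensional ℝ E]
  [MeasurableSpace E] [BorelSpace E]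

/-- The Gaussian exponential weight `exp (⟪b, z⟫ - a ‖z‖² / 2)`. -/
noncomputable def tiltWeight (b : E) (a : ℝ) (z : E) : ℝ := Real.exp (⟪b, z⟫ - a * ‖z‖ ^ 2 / 2)

/-- The partition function of the exponential weight under `μ`. -/
noncomputable def tiltPartition (μ : Measure E) (b : E) (a : ℝ) : ℝ := ∫ z, tiltWeight b a z ∂μ

/-- The mean of `μ` reweighted by `tiltWeight b a`. -/
noncomputable def tiltMean (μ : Measure E) (b : E) (a : ℝ) : E :=
  (tiltPartition μ b a)⁻¹ • ∫ z, tiltWeight b a z • z ∂μ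

lemma tiltWeight_pos (b : E) (a : ℝ) (z : E) : 0 < tiltWeight b a z := Real.exp_pos _

@[fun_prop]
lemma continuous_tiltWeight (b : E) (a : ℝ) : Continuous (tiltWeight b a) := by
  unfold tiltWeight; fun_prop

/-- A bound on the weight against cubic polynomials, for `‖b‖ ≤ R` and `a ≥ a₀`. -/
noncomputable def tiltBound (R a₀ : ℝ) : ℝ := 6 * Real.exp (1 + (R + 1) ^ 2 / (2 * a₀))

lemma tiltBound_pos (R a₀ : ℝ) : 0 < tiltBound R a₀ := by unfold tiltBound; positivity

lemma tiltWeight_mul_le {R a₀ a : ℝ} {b : E} (ha₀ : 0 < a₀) (hb : ‖b‖ ≤ R) (ha : a₀ ≤ a) (z : E) :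
    tiltWeight b a z * (1 + ‖z‖) ^ 3 ≤ tiltBound R a₀ := by
  have h1 : (1 + ‖z‖) ^ 3 ≤ 6 * Real.exp (1 + ‖z‖) := by
    have := Real.pow_div_factorial_le_exp (x := 1 + ‖z‖) (by positivity) 3
    rw [div_le_iff₀ (by positivity)] at this
    norm_num [Nat.factorial] at this
    linarith
  have h2 : ⟪b, z⟫ ≤ R * ‖z‖ := (real_inner_le_norm b z).trans (by gcongr)
  have h3 : (R + 1) * ‖z‖ ≤ a₀ * ‖z‖ ^ 2 / 2 + (R + 1) ^ 2 / (2 * a₀) := by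
    have : a₀ * ‖z‖ ^ 2 / 2 + (R + 1) ^ 2 / (2 * a₀) - (R + 1) * ‖z‖ =
        (a₀ * ‖z‖ - (R + 1)) ^ 2 / (2 * a₀) := by field_simp; ring
    have h : 0 ≤ (a₀ * ‖z‖ - (R + 1)) ^ 2 / (2 * a₀) := by positivity
    linarith
  have h4 : a₀ * ‖z‖ ^ 2 ≤ a * ‖z‖ ^ 2 := by gcongr
  calc tiltWeight b a z * (1 + ‖z‖) ^ 3
      ≤ Real.exp (⟪b, z⟫ - a * ‖z‖ ^ 2 / 2) * (6 * Real.exp (1 + ‖z‖)) := by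
        unfold tiltWeight; gcongr
    _ = 6 * Real.exp (⟪b, z⟫ - a * ‖z‖ ^ 2 / 2 + (1 + ‖z‖)) := by
        rw [Real.exp_add _ (1 + ‖z‖)]; ring
    _ ≤ tiltBound R a₀ := by
        unfold tiltBound
        exact mul_le_mul_of_nonneg_left (Real.exp_le_exp.2 (by linarith)) (by norm_num)

lemma tiltWeight_mul_le' {R a₀ a : ℝ} {b : E} (ha₀ : 0 < a₀) (hb : ‖b‖ ≤ R) (ha : a₀ ≤ a) (z : E)
    {x : ℝ} (hx : x ≤ (1 + ‖z‖) ^ 3) : tiltWeight b a z * x ≤ tiltBound R a₀ :=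
  (mul_le_mul_of_nonneg_left hx (tiltWeight_pos b a z).le).trans (tiltWeight_mul_le ha₀ hb ha z)

variable (μ : Measure E) [IsProbabilityMeasure μ]

lemma integrable_tiltWeight (b : E) {a : ℝ} (ha : 0 < a) : Integrable (tiltWeight b a) μ :=
  Integrable.of_bound (by fun_prop) (tiltBound ‖b‖ a) (Eventually.of_forall fun z => by
    rw [Real.norm_of_nonneg (tiltWeight_pos b a z).le]
    simpa using tiltWeight_mul_le' ha le_rfl le_rfl z (x := 1)
      (one_le_pow₀ (by linarith [norm_nonneg z])))

lemma integrable_tiltWeight_smul (b : E) {a : ℝ} (ha : 0 < a) :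
    Integrable (fun z => tiltWeight b a z • z) μ :=
  Integrable.of_bound (by fun_prop) (tiltBound ‖b‖ a) (Eventually.of_forall fun z => by
    rw [norm_smul, Real.norm_of_nonneg (tiltWeight_pos b a z).le]
    exact tiltWeight_mul_le' ha le_rfl le_rfl z (by
      nlinarith [norm_nonneg z, pow_nonneg (norm_nonneg z) 2, pow_nonneg (norm_nonneg z) 3]))

lemma tiltPartition_pos (b : E) {a : ℝ} (ha : 0 < a) : 0 < tiltPartition μ b a :=
  integral_exp_pos (integrable_tiltWeight μ b ha)

lemma tiltPartition_smul_tiltMean (b : E) {a : ℝ} (ha : 0 < a) :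
    tiltPartition μ b a • tiltMean μ b a = ∫ z, tiltWeight b a z • z ∂μ := by
  rw [tiltMean, smul_inv_smul₀ (tiltPartition_pos μ b ha).ne']

lemma exists_half_le_measureReal_closedBall :
    ∃ ρ : ℝ, 0 ≤ ρ ∧ 1 / 2 ≤ μ.real (Metric.closedBall 0 ρ) := by
  have h1 : Tendsto (fun n : ℕ => μ (Metric.closedBall (0 : E) n)) atTop (𝓝 1) := by
    have := tendsto_measure_iUnion_atTop (μ := μ)
      (s := fun n : ℕ => Metric.closedBall (0 : E) n)
      (fun m n hmn => Metric.closedBall_subset_closedBall (by exact_mod_cast hmn))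
    rwa [Metric.iUnion_closedBall_nat, measure_univ] at this
  have h2 := (ENNReal.tendsto_toReal ENNReal.one_ne_top).comp h1
  obtain ⟨n, hn⟩ := (h2.eventually_const_le (u := 1 / 2) (by norm_num)).exists
  exact ⟨n, by positivity, hn⟩

/-- A lower bound for the integral of a weight from a lower bound on a set of mass `≥ 1/2`. -/
lemma half_mul_le_tiltPartition {ρ D : ℝ} (hρ : 1 / 2 ≤ μ.real (Metric.closedBall 0 ρ)) {b : E}
    {a : ℝ} (ha : 0 < a) (hD : 0 ≤ D) (h : ∀ z, ‖z‖ ≤ ρ → D ≤ tiltWeight b a z) :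
    D ≤ 2 * tiltPartition μ b a := by
  have h1 : ∫ z in Metric.closedBall 0 ρ, D ∂μ ≤ ∫ z in Metric.closedBall 0 ρ, tiltWeight b a z ∂μ :=
    setIntegral_mono_on (integrable_const D) (integrable_tiltWeight μ b ha).integrableOn
      Metric.isClosed_closedBall.measurableSet (fun z hz => h z (by simpa using hz))
  have h2 : ∫ z in Metric.closedBall 0 ρ, tiltWeight b a z ∂μ ≤ tiltPartition μ b a :=
    setIntegral_le_integral (integrable_tiltWeight μ b ha)
      (Eventually.of_forall fun z => (tiltWeight_pos b a z).le)
  rw [setIntegral_const, smul_eq_mul] at h1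
  nlinarith

/-- The tilted mean grows at most linearly in the tilt `b`. The weight is Gaussian around
`c = b / a`, and a region at distance at most `s = ρ + ‖c‖ + 1` from `c` carries half of the mass
of `μ`; the points further away than that are suppressed. -/
lemma norm_tiltMean_le {ρ : ℝ} (hρ0 : 0 ≤ ρ) (hρ : 1 / 2 ≤ μ.real (Metric.closedBall 0 ρ)) (b : E)
    {a : ℝ} (ha : 0 < a) : ‖tiltMean μ b a‖ ≤ 2 * (‖b‖ / a) + ρ + 1 + 2 / a := by
  set c : E := a⁻¹ • b with hc
  have hcn : ‖c‖ = ‖b‖ / a := by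
    rw [hc, norm_smul, norm_inv, Real.norm_of_nonneg ha.le]; ring
  set s : ℝ := ρ + ‖c‖ + 1 with hs
  have hs1 : 1 ≤ s := by have := norm_nonneg c; linarith
  have hw : ∀ z, tiltWeight b a z = Real.exp (a * ‖c‖ ^ 2 / 2 - a * ‖z - c‖ ^ 2 / 2) := fun z => by
    have hbc : b = a • c := by rw [hc, smul_inv_smul₀ ha.ne']
    rw [tiltWeight, norm_sub_sq_real, hbc, real_inner_smul_left, real_inner_comm]
    congr 1; ring
  set D : ℝ := Real.exp (a * ‖c‖ ^ 2 / 2 - a * s ^ 2 / 2) with hDdef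
  have hD : D ≤ 2 * tiltPartition μ b a := by
    refine half_mul_le_tiltPartition μ hρ ha (Real.exp_pos _).le fun z hz => ?_
    rw [hw, hDdef]
    have : ‖z - c‖ ≤ s := (norm_sub_le z c).trans (by linarith)
    gcongr
  have hpt : ∀ z, tiltWeight b a z * ‖z - c‖ ≤ s * tiltWeight b a z + D / a := fun z => by
    set r := ‖z - c‖ with hr
    have hr0 : 0 ≤ r := norm_nonneg _
    have h1 : tiltWeight b a z = D * Real.exp (-(a * (r ^ 2 - s ^ 2) / 2)) := by
      rw [hw, hDdef, ← Real.exp_add]; congr 1; ring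
    have h2 : a * (r ^ 2 - s ^ 2) / 2 * Real.exp (-(a * (r ^ 2 - s ^ 2) / 2)) ≤ 1 := by
      have h := Real.add_one_le_exp (a * (r ^ 2 - s ^ 2) / 2)
      rw [Real.exp_neg, ← div_eq_mul_inv, div_le_one (Real.exp_pos _)]
      linarith
    have hDp : 0 < D := Real.exp_pos _
    rcases le_total r s with hrs | hrs
    · have := tiltWeight_pos b a z
      have : 0 < D / a := by positivity
      nlinarith
    · have h3 : r - s ≤ (r ^ 2 - s ^ 2) / 2 := by nlinarith
      have h4 : tiltWeight b a z * (r - s) ≤ D / a := by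
        rw [le_div_iff₀ ha]
        calc tiltWeight b a z * (r - s) * a
            ≤ tiltWeight b a z * ((r ^ 2 - s ^ 2) / 2) * a := by
              have := (tiltWeight_pos b a z).le
              gcongr
          _ = D * (a * (r ^ 2 - s ^ 2) / 2 * Real.exp (-(a * (r ^ 2 - s ^ 2) / 2))) := by
              rw [h1]; ring
          _ ≤ D * 1 := by gcongr
          _ = D := mul_one D
      linarith
  have hZ := tiltPartition_pos μ b ha
  have hk := integrable_tiltWeight μ b ha
  have hI : ‖(∫ z, tiltWeight b a z • z ∂μ) - tiltPartition μ b a • c‖ ≤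
      s * tiltPartition μ b a + D / a := by
    rw [tiltPartition, ← integral_smul_const, ← integral_sub (integrable_tiltWeight_smul μ b ha)
      (hk.smul_const c)]
    have hE : ∫ z, (s * tiltWeight b a z + D / a) ∂μ = s * ∫ z, tiltWeight b a z ∂μ + D / a := by
      rw [integral_add (hk.const_mul s) (integrable_const _), integral_const_mul]
      simp
    rw [← hE]
    refine norm_integral_le_of_norm_le ((hk.const_mul s).add (integrable_const _))
      (Eventually.of_forall fun z => ?_)
    rw [← smul_sub, norm_smul, Real.norm_of_nonneg (tiltWeight_pos b a z).le]
    exact hpt z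
  have hM : ‖tiltMean μ b a - c‖ ≤ s + 2 / a := by
    have h1 : tiltMean μ b a - c = (tiltPartition μ b a)⁻¹ •
        ((∫ z, tiltWeight b a z • z ∂μ) - tiltPartition μ b a • c) := by
      rw [tiltMean, smul_sub, inv_smul_smul₀ hZ.ne']
    rw [h1, norm_smul, norm_inv, Real.norm_of_nonneg hZ.le, inv_mul_le_iff₀ hZ]
    refine hI.trans ?_
    have : D / a ≤ 2 * tiltPartition μ b a / a := by gcongr
    calc s * tiltPartition μ b a + D / a ≤ s * tiltPartition μ b a + 2 * tiltPartition μ b a / a := by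
          linarith
      _ = tiltPartition μ b a * (s + 2 / a) := by ring
  have := norm_le_norm_add_norm_sub' (tiltMean μ b a) c
  rw [← hcn]
  linarith

lemma abs_exp_sub_exp_le (x y : ℝ) :
    |Real.exp x - Real.exp y| ≤ (Real.exp x + Real.exp y) * |x - y| := by
  have key : ∀ u v : ℝ, Real.exp u - Real.exp v ≤ Real.exp u * |u - v| := fun u v => by
    have h := Real.add_one_le_exp (v - u)
    have h2 : Real.exp v = Real.exp u * Real.exp (v - u) := by rw [← Real.exp_add]; congr 1; ring
    rw [h2]
    nlinarith [Real.exp_pos u, le_abs_self (u - v)]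
  have h1 := key x y
  have h2 := key y x
  rw [abs_sub_comm y x] at h2
  rw [abs_le]
  constructor <;> nlinarith [mul_nonneg (Real.exp_pos x).le (abs_nonneg (x - y)),
    mul_nonneg (Real.exp_pos y).le (abs_nonneg (x - y))]

lemma abs_tiltWeight_sub_mul_le {R a₀ : ℝ} (ha₀ : 0 < a₀) {b b' : E} {a a' : ℝ} (hb : ‖b‖ ≤ R)
    (hb' : ‖b'‖ ≤ R) (ha : a₀ ≤ a) (ha' : a₀ ≤ a') (z : E) :
    |tiltWeight b a z - tiltWeight b' a' z| * (1 + ‖z‖) ≤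
      2 * tiltBound R a₀ * (‖b - b'‖ + |a - a'|) := by
  have h1 : |(⟪b, z⟫ - a * ‖z‖ ^ 2 / 2) - (⟪b', z⟫ - a' * ‖z‖ ^ 2 / 2)| ≤
      (‖b - b'‖ + |a - a'|) * (1 + ‖z‖) ^ 2 := by
    have e : (⟪b, z⟫ - a * ‖z‖ ^ 2 / 2) - (⟪b', z⟫ - a' * ‖z‖ ^ 2 / 2) =
        ⟪b - b', z⟫ - (a - a') * (‖z‖ ^ 2 / 2) := by rw [inner_sub_left]; ring
    rw [e]
    refine (abs_sub _ _).trans ?_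
    rw [abs_mul, abs_of_nonneg (by positivity : 0 ≤ ‖z‖ ^ 2 / 2)]
    have h2 := abs_real_inner_le_norm (b - b') z
    have h3 : ‖z‖ ≤ (1 + ‖z‖) ^ 2 := by nlinarith [norm_nonneg z]
    have h4 : ‖z‖ ^ 2 / 2 ≤ (1 + ‖z‖) ^ 2 := by nlinarith [norm_nonneg z]
    rw [add_mul]
    exact add_le_add (h2.trans (by gcongr)) (by gcongr)
  calc |tiltWeight b a z - tiltWeight b' a' z| * (1 + ‖z‖)
      ≤ ((tiltWeight b a z + tiltWeight b' a' z) *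
          ((‖b - b'‖ + |a - a'|) * (1 + ‖z‖) ^ 2)) * (1 + ‖z‖) := by
        refine mul_le_mul_of_nonneg_right ((abs_exp_sub_exp_le _ _).trans ?_) (by positivity)
        exact mul_le_mul_of_nonneg_left h1
          (add_pos (tiltWeight_pos b a z) (tiltWeight_pos b' a' z)).le
    _ = (tiltWeight b a z * (1 + ‖z‖) ^ 3 + tiltWeight b' a' z * (1 + ‖z‖) ^ 3) *
          (‖b - b'‖ + |a - a'|) := by ring
    _ ≤ (tiltBound R a₀ + tiltBound R a₀) * (‖b - b'‖ + |a - a'|) := by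
        gcongr
        · exact tiltWeight_mul_le ha₀ hb ha z
        · exact tiltWeight_mul_le ha₀ hb' ha' z
    _ = _ := by ring

/-- The tilted mean is Lipschitz in both parameters on bounded sets where `a ≥ a₀ > 0`. -/
lemma exists_lipschitz_tiltMean (R : ℝ) {a₀ : ℝ} (ha₀ : 0 < a₀) (a₁ : ℝ) :
    ∃ K : ℝ, 0 ≤ K ∧ ∀ (b b' : E) (a a' : ℝ), ‖b‖ ≤ R → ‖b'‖ ≤ R → a₀ ≤ a → a₀ ≤ a' → a ≤ a₁ →
      ‖tiltMean μ b a - tiltMean μ b' a'‖ ≤ K * (‖b - b'‖ + |a - a'|) := by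
  obtain ⟨ρ, hρ0, hρ⟩ := exists_half_le_measureReal_closedBall μ
  set D := Real.exp (-(R * ρ + a₁ * ρ ^ 2 / 2)) with hD
  have hDp : 0 < D := Real.exp_pos _
  set B := tiltBound R a₀ with hB
  have hBp : 0 < B := tiltBound_pos R a₀
  set C := 2 * (|R| / a₀) + ρ + 1 + 2 / a₀ with hC
  have hCp : 0 ≤ C := by positivity
  refine ⟨4 * B * (1 + C) / D, by positivity, fun b b' a a' hb hb' ha ha' ha1 => ?_⟩
  have hap : 0 < a := ha₀.trans_le ha
  have hap' : 0 < a' := ha₀.trans_le ha'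
  set Δ := ‖b - b'‖ + |a - a'| with hΔ
  have hΔ0 : 0 ≤ Δ := by positivity
  have hZ := tiltPartition_pos μ b hap
  have hZD : D ≤ 2 * tiltPartition μ b a := by
    refine half_mul_le_tiltPartition μ hρ hap hDp.le fun z hz => ?_
    rw [hD, tiltWeight]
    have h1 : -(R * ρ) ≤ ⟪b, z⟫ := by
      have h := abs_le.1 (abs_real_inner_le_norm b z)
      have h' : ‖b‖ * ‖z‖ ≤ R * ρ :=
        mul_le_mul hb hz (norm_nonneg z) ((norm_nonneg b).trans hb)
      linarith [h.1]
    have h2 : a * ‖z‖ ^ 2 ≤ a₁ * ρ ^ 2 := by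
      have := hap.le
      gcongr
      exact this.trans ha1
    gcongr
    linarith
  have hC' : ‖tiltMean μ b' a'‖ ≤ C := by
    refine (norm_tiltMean_le μ hρ0 hρ b' hap').trans ?_
    have h1 : ‖b'‖ / a' ≤ |R| / a₀ := by
      gcongr
      exact hb'.trans (le_abs_self R)
    have h2 : 2 / a' ≤ 2 / a₀ := by gcongr
    linarith
  have hdiff := abs_tiltWeight_sub_mul_le ha₀ hb hb' ha ha'
  have hdZ : |tiltPartition μ b a - tiltPartition μ b' a'| ≤ 2 * B * Δ := by
    rw [tiltPartition, tiltPartition, ← integral_sub (integrable_tiltWeight μ b hap)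
      (integrable_tiltWeight μ b' hap'), ← Real.norm_eq_abs]
    have := norm_integral_le_of_norm_le_const (μ := μ) (C := 2 * B * Δ)
      (f := fun z => tiltWeight b a z - tiltWeight b' a' z) (Eventually.of_forall fun z => by
        rw [Real.norm_eq_abs]
        refine le_trans ?_ (hdiff z)
        exact le_mul_of_one_le_right (abs_nonneg _) (by linarith [norm_nonneg z]))
    simpa using this
  have hdN : ‖(∫ z, tiltWeight b a z • z ∂μ) - ∫ z, tiltWeight b' a' z • z ∂μ‖ ≤ 2 * B * Δ := by
    rw [← integral_sub (integrable_tiltWeight_smul μ b hap) (integrable_tiltWeight_smul μ b' hap')]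
    have := norm_integral_le_of_norm_le_const (μ := μ) (C := 2 * B * Δ)
      (f := fun z => tiltWeight b a z • z - tiltWeight b' a' z • z) (Eventually.of_forall fun z => by
        rw [← sub_smul, norm_smul, Real.norm_eq_abs]
        refine le_trans ?_ (hdiff z)
        gcongr
        linarith)
    simpa using this
  have key : tiltPartition μ b a • (tiltMean μ b a - tiltMean μ b' a') =
      ((∫ z, tiltWeight b a z • z ∂μ) - ∫ z, tiltWeight b' a' z • z ∂μ) -
        (tiltPartition μ b a - tiltPartition μ b' a') • tiltMean μ b' a' := by
    rw [smul_sub, tiltPartition_smul_tiltMean μ b hap, sub_smul,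
      tiltPartition_smul_tiltMean μ b' hap']
    abel
  have h3 : tiltPartition μ b a * ‖tiltMean μ b a - tiltMean μ b' a'‖ ≤ 2 * B * Δ * (1 + C) := by
    rw [← Real.norm_of_nonneg hZ.le, ← norm_smul, key]
    refine (norm_sub_le _ _).trans ?_
    rw [norm_smul, Real.norm_eq_abs, mul_add, mul_one]
    exact add_le_add hdN (mul_le_mul hdZ hC' (norm_nonneg _) (by positivity))
  rw [div_mul_eq_mul_div, le_div_iff₀ hDp]
  have h4 := mul_le_mul_of_nonneg_right hZD (norm_nonneg (tiltMean μ b a - tiltMean μ b' a'))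
  linarith

/-- The mean of `μ` under the weight with parameters `u • w + b₀` and `u² + a₀`. In the variable
`w = x̄ / σ` and the time `u = α / σ`, this is the velocity of the GLASS posterior ODE. -/
noncomputable def tiltField (b₀ : E) (a₀ : ℝ) (u : ℝ) (w : E) : E :=
  tiltMean μ (u • w + b₀) (u ^ 2 + a₀)

lemma isTameField_tiltField (b₀ : E) {a₀ : ℝ} (ha₀ : 0 < a₀) :
    IsTameField (tiltField μ b₀ a₀) where
  lipschitz N R := by
    obtain ⟨K, hK, hl⟩ := exists_lipschitz_tiltMean μ (|N| * |R| + ‖b₀‖) ha₀ (N ^ 2 + a₀)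
    refine ⟨K * (|N| + |R| + 2 * |N|), by positivity, fun u v w z hu hv hw hz => ?_⟩
    replace hu := hu.trans (le_abs_self N)
    replace hv := hv.trans (le_abs_self N)
    replace hw := hw.trans (le_abs_self R)
    replace hz := hz.trans (le_abs_self R)
    have hb : ∀ (s : ℝ) (y : E), |s| ≤ |N| → ‖y‖ ≤ |R| → ‖s • y + b₀‖ ≤ |N| * |R| + ‖b₀‖ :=
      fun s y hs hy => by
        refine (norm_add_le _ _).trans ?_
        rw [norm_smul, Real.norm_eq_abs]
        gcongr
    refine (hl (u • w + b₀) (v • z + b₀) (u ^ 2 + a₀) (v ^ 2 + a₀) (hb u w hu hw) (hb v z hv hz)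
      (by nlinarith) (by nlinarith) (by linarith [sq_le_sq.2 hu])).trans ?_
    rw [mul_assoc]
    refine mul_le_mul_of_nonneg_left ?_ hK
    have h1 : ‖(u • w + b₀) - (v • z + b₀)‖ ≤ |N| * ‖w - z‖ + |u - v| * |R| := by
      have e : (u • w + b₀) - (v • z + b₀) = u • (w - z) + (u - v) • z := by module
      rw [e]
      refine (norm_add_le _ _).trans ?_
      rw [norm_smul, norm_smul, Real.norm_eq_abs, Real.norm_eq_abs]
      gcongr
    have h2 : |(u ^ 2 + a₀) - (v ^ 2 + a₀)| ≤ 2 * |N| * |u - v| := by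
      have e : (u ^ 2 + a₀) - (v ^ 2 + a₀) = (u + v) * (u - v) := by ring
      rw [e, abs_mul]
      gcongr
      linarith [abs_add_le u v]
    nlinarith [mul_nonneg (abs_nonneg R) (norm_nonneg (w - z)), mul_nonneg (abs_nonneg N)
      (norm_nonneg (w - z)), mul_nonneg (abs_nonneg N) (abs_nonneg (u - v))]
  growth N := by
    obtain ⟨ρ, hρ0, hρ⟩ := exists_half_le_measureReal_closedBall μ
    refine ⟨2 * ((|N| + ‖b₀‖) / a₀) + ρ + 1 + 2 / a₀, by positivity, fun u w hu => ?_⟩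
    replace hu := hu.trans (le_abs_self N)
    have ha : a₀ ≤ u ^ 2 + a₀ := by nlinarith
    refine (norm_tiltMean_le μ hρ0 hρ _ (ha₀.trans_le ha)).trans ?_
    have h1 : ‖u • w + b₀‖ / (u ^ 2 + a₀) ≤ (|N| + ‖b₀‖) / a₀ * (1 + ‖w‖) := by
      rw [div_mul_eq_mul_div]
      gcongr
      refine (norm_add_le _ _).trans ?_
      rw [norm_smul, Real.norm_eq_abs]
      have : |u| * ‖w‖ ≤ |N| * ‖w‖ := by gcongr
      nlinarith [norm_nonneg w, abs_nonneg N, mul_nonneg (norm_nonneg b₀) (norm_nonneg w)]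
    have h2 : 2 / (u ^ 2 + a₀) ≤ 2 / a₀ := by gcongr
    have h3 : 0 ≤ (ρ + 1 + 2 / a₀) * ‖w‖ := by positivity
    nlinarith

end Tilt

/-! ### Gaussian densities -/

section Gaussian

open scoped RealInnerProductSpace

variable {d : ℕ}

lemma gaussianDensity_pos (m : Pt d) {v : ℝ} (hv : 0 < v) (x : Pt d) :
    0 < gaussianDensity m v x := by
  unfold gaussianDensity; positivity

@[fun_prop]
lemma measurable_gaussianDensity {X : Type*} [MeasurableSpace X] {m x : X → Pt d} (v : ℝ)
    (hm : Measurable m) (hx : Measurable x) :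
    Measurable fun p => gaussianDensity (m p) v (x p) := by
  unfold gaussianDensity; fun_prop

@[fun_prop]
lemma continuous_gaussianDensity {X : Type*} [TopologicalSpace X] {m x : X → Pt d} (v : ℝ)
    (hm : Continuous m) (hx : Continuous x) :
    Continuous fun p => gaussianDensity (m p) v (x p) := by
  unfold gaussianDensity; fun_prop

lemma gaussianDensity_le (m : Pt d) {v : ℝ} (hv : 0 < v) (x : Pt d) :
    gaussianDensity m v x ≤ (√(2 * Real.pi * v) ^ d)⁻¹ := by
  unfold gaussianDensity
  refine mul_le_of_le_one_right (by positivity) (Real.exp_le_one_iff.2 ?_)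
  rw [neg_div]
  exact neg_nonpos.2 (by positivity)

/-- As a function of the mean, a Gaussian density is an exponential weight. -/
lemma gaussianDensity_smul_eq (a : ℝ) {v : ℝ} (hv : v ≠ 0) (x z : Pt d) :
    gaussianDensity (a • z) v x =
      gaussianDensity 0 v x * tiltWeight ((a / v) • x) (a ^ 2 / v) z := by
  unfold gaussianDensity tiltWeight
  rw [mul_assoc (√(2 * Real.pi * v) ^ d)⁻¹, ← Real.exp_add, norm_sub_sq_real, norm_smul,
    inner_smul_right, inner_smul_left, Real.norm_eq_abs, mul_pow, sq_abs]
  congr 2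
  simp only [sub_zero, conj_trivial]
  field_simp
  ring

/-- The affine images of the standard Gaussian law have the Gaussian densities. -/
lemma map_stdGaussian_eq_withDensity (c : Pt d) {s : ℝ} (hs : 0 < s) :
    (stdGaussian (Pt d)).map (fun ε => c + s • ε) =
      volume.withDensity fun y => ENNReal.ofReal (gaussianDensity c (s ^ 2) y) := by
  have hs2 : 0 < s ^ 2 := by positivity
  set b : ℝ := 1 / (2 * s ^ 2) with hb
  have hbp : 0 < b := by positivity
  have hint : Integrable (fun y : Pt d => gaussianDensity c (s ^ 2) y) := by
    have h0 : Integrable (fun y : Pt d => Real.exp (-b * ‖y‖ ^ 2)) := by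
      have := (GaussianFourier.integrable_cexp_neg_mul_sq_norm_add (b := (b : ℂ))
        (by simpa using hbp) 0 (0 : Pt d)).norm
      refine this.congr (Eventually.of_forall fun y => ?_)
      simp only [zero_mul, add_zero]
      rw [Complex.norm_exp]
      congr 1
      rw [show (-(b : ℂ) * (‖y‖ : ℂ) ^ 2) = ((-b * ‖y‖ ^ 2 : ℝ) : ℂ) by push_cast; ring,
        Complex.ofReal_re]
    have h1 := (h0.comp_sub_right c).const_mul (√(2 * Real.pi * s ^ 2) ^ d)⁻¹
    refine h1.congr (Eventually.of_forall fun y => ?_)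
    simp only [gaussianDensity, hb]
    congr 2
    field_simp
  have : IsFiniteMeasure (volume.withDensity fun y : Pt d =>
      ENNReal.ofReal (gaussianDensity c (s ^ 2) y)) :=
    isFiniteMeasure_withDensity_ofReal hint.2
  have : IsProbabilityMeasure ((stdGaussian (Pt d)).map (fun ε => c + s • ε)) :=
    Measure.isProbabilityMeasure_map (by fun_prop)
  refine Measure.ext_of_charFun (funext fun t => ?_)
  have hL : charFun ((stdGaussian (Pt d)).map (fun ε => c + s • ε)) t =
      Complex.exp (-‖s • t‖ ^ 2 / 2) * Complex.exp (⟪c, t⟫ * Complex.I) := by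
    have : (fun ε : Pt d => c + s • ε) = (fun y => c + y) ∘ fun ε => s • ε := rfl
    rw [this, ← Measure.map_map (by fun_prop) (by fun_prop), charFun_map_const_add,
      charFun_map_smul, charFun_stdGaussian]
  have hR : charFun (volume.withDensity fun y : Pt d =>
      ENNReal.ofReal (gaussianDensity c (s ^ 2) y)) t =
      ∫ y : Pt d, ((√(2 * Real.pi * s ^ 2) ^ d)⁻¹ : ℝ) * Complex.exp (⟪c, t⟫ * Complex.I) *
        Complex.exp (-b * ‖y‖ ^ 2 + Complex.I * ⟪t, y⟫) := by
    rw [charFun_apply, integral_withDensity_eq_integral_toReal_smul (by fun_prop)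
      (Eventually.of_forall fun y => ENNReal.ofReal_lt_top), ← integral_add_right_eq_self _ c]
    refine integral_congr_ae (Eventually.of_forall fun y => ?_)
    simp only
    rw [ENNReal.toReal_ofReal (gaussianDensity_pos c hs2 _).le, gaussianDensity, add_sub_cancel_right,
      Complex.real_smul, Complex.ofReal_mul, mul_assoc (((√(2 * Real.pi * s ^ 2) ^ d)⁻¹ : ℝ) : ℂ),
      mul_assoc (((√(2 * Real.pi * s ^ 2) ^ d)⁻¹ : ℝ) : ℂ), Complex.ofReal_exp,
      ← Complex.exp_add, ← Complex.exp_add]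
    congr 2
    rw [inner_add_left, real_inner_comm t y, hb]
    push_cast
    field_simp
    ring
  rw [hL, hR, integral_const_mul, GaussianFourier.integral_cexp_neg_mul_sq_norm_add
    (by simpa using hbp)]
  have hpow : ((Real.pi : ℂ) / (b : ℂ)) ^ ((Module.finrank ℝ (Pt d) : ℂ) / 2) =
      ((√(2 * Real.pi * s ^ 2) ^ d : ℝ) : ℂ) := by
    have h1 : (Real.pi : ℂ) / (b : ℂ) = ((2 * Real.pi * s ^ 2 : ℝ) : ℂ) := by
      rw [hb]; push_cast; field_simp
    have h2 : √(2 * Real.pi * s ^ 2) ^ d = (2 * Real.pi * s ^ 2) ^ ((d : ℝ) / 2) := by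
      rw [Real.sqrt_eq_rpow, ← Real.rpow_natCast (_ ^ (1 / 2 : ℝ)) d, ← Real.rpow_mul
        (by positivity)]
      congr 1
      ring
    rw [h1, h2, finrank_euclideanSpace_fin, Complex.ofReal_cpow (by positivity)]
    push_cast
    rfl
  have hne : ((√(2 * Real.pi * s ^ 2) ^ d : ℝ) : ℂ) ≠ 0 := by
    exact_mod_cast (by positivity : (√(2 * Real.pi * s ^ 2) ^ d) ≠ 0)
  have hexp : Complex.I ^ 2 * (‖t‖ : ℂ) ^ 2 / (4 * b) = -(‖s • t‖ : ℂ) ^ 2 / 2 := by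
    rw [Complex.I_sq, norm_smul, Real.norm_of_nonneg hs.le, hb]
    push_cast
    field_simp
    ring
  rw [hpow, hexp, Complex.ofReal_inv]
  field_simp

lemma lintegral_stdGaussian_affine (c : Pt d) {s : ℝ} (hs : 0 < s) {F : Pt d → ℝ≥0∞}
    (hF : Measurable F) :
    ∫⁻ ε, F (c + s • ε) ∂(stdGaussian (Pt d)) =
      ∫⁻ y, ENNReal.ofReal (gaussianDensity c (s ^ 2) y) * F y := by
  rw [← lintegral_map hF (by fun_prop), map_stdGaussian_eq_withDensity c hs,
    lintegral_withDensity_eq_lintegral_mul _ (by fun_prop) hF]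
  rfl

end Gaussian

/-! ### Measures are determined by Lipschitz functions -/

section Ext

/-- Finite measures on a proper space that agree on compactly supported Lipschitz functions are
equal. -/
lemma ext_of_forall_integral_lipschitz {E : Type*} [NormedAddCommGroup E] [ProperSpace E]
    [MeasurableSpace E] [BorelSpace E] {μ ν : Measure E} [IsFiniteMeasure μ] [IsFiniteMeasure ν]
    (h : ∀ (φ : E → ℝ) (L : ℝ≥0) (r : ℝ), LipschitzWith L φ → (∀ x, r < ‖x‖ → φ x = 0) →
      ∫ x, φ x ∂μ = ∫ x, φ x ∂ν) : μ = ν := by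
  apply Measure.OuterRegular.ext_isOpen
  apply Measure.InnerRegularWRT.eq_of_innerRegularWRT_of_forall_eq Measure.Regular.innerRegular
    Measure.Regular.innerRegular
  intro K hK
  have hpos : ∀ n : ℕ, (0 : ℝ) < 1 / ((n : ℝ) + 1) := fun n => by positivity
  have h1 := tendsto_integral_thickenedIndicator_of_isClosed μ hK.isClosed hpos
    tendsto_one_div_add_atTop_nhds_zero_nat
  have h2 := tendsto_integral_thickenedIndicator_of_isClosed ν hK.isClosed hpos
    tendsto_one_div_add_atTop_nhds_zero_nat
  have heq : ∀ n : ℕ, ∫ x, (thickenedIndicator (hpos n) K x : ℝ) ∂μ =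
      ∫ x, (thickenedIndicator (hpos n) K x : ℝ) ∂ν := fun n => by
    obtain ⟨r, hr⟩ := (hK.isBounded.thickening (δ := 1 / ((n : ℝ) + 1))).subset_closedBall 0
    refine h _ _ r (lipschitzWith_thickenedIndicator (hpos n) K) fun x hx => ?_
    have hx' : x ∉ Metric.thickening (1 / ((n : ℝ) + 1)) K := fun hmem => by
      have := hr hmem
      rw [mem_closedBall_zero_iff] at this
      linarith
    rw [thickenedIndicator_zero (hpos n) K hx', NNReal.coe_zero]
  simp_rw [heq] at h1
  have := tendsto_nhds_unique h1 h2
  rwa [Measure.real, Measure.real, ENNReal.toReal_eq_toReal_iff' (by finiteness) (by finiteness)]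
    at this

end Ext

/-! ### Transport of the Gaussian law by the field of conditional means -/

section Law

variable {d : ℕ}

/-- The joint law of `z` and `u z + ε`, in terms of its density in the second variable. -/
lemma map_shear_eq_withDensity (ν : Measure (Pt d)) [IsFiniteMeasure ν] (u : ℝ) :
    (ν.prod (stdGaussian (Pt d))).map (fun p => (p.1, u • p.1 + p.2)) =
      (ν.prod volume).withDensity fun p => ENNReal.ofReal (gaussianDensity (u • p.1) 1 p.2) := by
  refine Measure.ext_of_lintegral _ fun F hF => ?_
  rw [lintegral_map hF (by fun_prop), lintegral_withDensity_eq_lintegral_mul _ (by fun_prop) hF,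
    lintegral_prod _ (by fun_prop), lintegral_prod _ (by fun_prop)]
  refine lintegral_congr fun z => ?_
  have := lintegral_stdGaussian_affine (u • z) one_pos (F := fun w => F (z, w)) (by fun_prop)
  simpa using this

/-- A property that holds at almost every point of space holds at almost every value of
`u z + ε`. -/
lemma ae_shear {ν : Measure (Pt d)} [IsFiniteMeasure ν] (u : ℝ) {p : Pt d → Prop}
    (hp : ∀ᵐ w, p w) :
    ∀ᵐ q ∂(ν.prod (stdGaussian (Pt d))), p (u • q.1 + q.2) := by
  have h1 : ∀ᵐ q ∂(ν.prod (volume : Measure (Pt d))), p q.2 :=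
    Measure.quasiMeasurePreserving_snd.ae hp
  have h2 : ∀ᵐ q ∂((ν.prod (stdGaussian (Pt d))).map (fun p => (p.1, u • p.1 + p.2))), p q.2 := by
    rw [map_shear_eq_withDensity]
    exact (withDensity_absolutelyContinuous _ _).ae_le h1
  exact ae_of_ae_map (f := fun p : Pt d × Pt d => (p.1, u • p.1 + p.2)) (by fun_prop) h2

/-- `f` is the field of the conditional means of `z ∼ ν` given the value `w` of `u z + ε`, where
`ε` is a standard Gaussian independent of `z`. -/
def IsPosteriorMean (ν : Measure (Pt d)) (f : ℝ → Pt d → Pt d) : Prop :=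
  ∀ u w, (∫ z, gaussianDensity (u • z) 1 w ∂ν) • f u w = ∫ z, gaussianDensity (u • z) 1 w • z ∂ν

lemma integrable_gaussianDensity_smul {ν : Measure (Pt d)} [IsFiniteMeasure ν] (u : ℝ) (w : Pt d) :
    Integrable (fun z => gaussianDensity (u • z) 1 w) ν := by
  refine Integrable.of_bound (by fun_prop) ((√(2 * Real.pi * 1) ^ d)⁻¹)
    (Eventually.of_forall fun z => ?_)
  rw [Real.norm_of_nonneg (gaussianDensity_pos _ one_pos _).le]
  exact gaussianDensity_le _ one_pos _

lemma integrable_gaussianDensity_smul_smul {ν : Measure (Pt d)} [IsFiniteMeasure ν]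
    (hν : Integrable (fun z => z) ν) (u : ℝ) (w : Pt d) :
    Integrable (fun z => gaussianDensity (u • z) 1 w • z) ν := by
  refine hν.bdd_smul (φ := fun z => gaussianDensity (u • z) 1 w) ((√(2 * Real.pi * 1) ^ d)⁻¹)
    (by fun_prop) (Eventually.of_forall fun z => ?_)
  rw [Real.norm_of_nonneg (gaussianDensity_pos _ one_pos _).le]
  exact gaussianDensity_le _ one_pos _

/-- The error `z - f(u z + ε)` of the conditional mean is orthogonal to functions of `u z + ε`. The
field `h` may differ from the conditional mean where the test function `A` vanishes. -/
lemma integral_posteriorMean_orthogonal {ν : Measure (Pt d)} [IsProbabilityMeasure ν]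
    (hν : Integrable (fun z => z) ν) {f : ℝ → Pt d → Pt d} (hf : IsPosteriorMean ν f) (u : ℝ)
    {A : Pt d → (Pt d →L[ℝ] ℝ)} (hA : Measurable A) {L : ℝ} (hAL : ∀ w, ‖A w‖ ≤ L)
    {h : Pt d → Pt d} (hh : Measurable h) {B : ℝ} (hhB : ∀ w, ‖h w‖ ≤ B)
    (hfh : ∀ w, A w ≠ 0 → h w = f u w) :
    ∫ p, A (u • p.1 + p.2) (h (u • p.1 + p.2) - p.1) ∂(ν.prod (stdGaussian (Pt d))) = 0 := by
  set F : Pt d × Pt d → ℝ := fun p => A p.2 (h p.2 - p.1) with hF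
  have hFm : Measurable F := by
    have h1 : Measurable fun q : (Pt d →L[ℝ] ℝ) × Pt d => q.1 q.2 :=
      (isBoundedBilinearMap_apply.continuous).measurable
    exact h1.comp ((hA.comp measurable_snd).prodMk ((hh.comp measurable_snd).sub measurable_fst))
  have hL0 : 0 ≤ L := (norm_nonneg _).trans (hAL 0)
  have hsm : Measurable fun p : Pt d × Pt d => (p.1, u • p.1 + p.2) := by fun_prop
  have hFi : Integrable (fun p : Pt d × Pt d => F (p.1, u • p.1 + p.2))
      (ν.prod (stdGaussian (Pt d))) := by
    have hb : Integrable (fun p : Pt d × Pt d => L * (B + ‖p.1‖)) (ν.prod (stdGaussian (Pt d))) :=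
      (((integrable_const B).add hν.norm).const_mul L).comp_fst _
    refine hb.mono' (hFm.comp hsm).aestronglyMeasurable (Eventually.of_forall fun p => ?_)
    refine ((A _).le_opNorm _).trans ?_
    exact mul_le_mul (hAL _) ((norm_sub_le _ _).trans (add_le_add_left (hhB _) _))
      (norm_nonneg _) hL0
  have e1 : ∫ p, F (p.1, u • p.1 + p.2) ∂(ν.prod (stdGaussian (Pt d))) =
      ∫ p, gaussianDensity (u • p.1) 1 p.2 * F p ∂(ν.prod volume) := by
    rw [← integral_map (f := F) hsm.aemeasurable hFm.aestronglyMeasurable,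
      map_shear_eq_withDensity, integral_withDensity_eq_integral_toReal_smul (by fun_prop)
      (Eventually.of_forall fun _ => ENNReal.ofReal_lt_top)]
    refine integral_congr_ae (Eventually.of_forall fun p => ?_)
    simp only [smul_eq_mul]
    rw [ENNReal.toReal_ofReal (gaussianDensity_pos _ one_pos _).le]
  have hi2 : Integrable (fun p => gaussianDensity (u • p.1) 1 p.2 * F p) (ν.prod volume) := by
    have h1 := (integrable_map_measure (f := fun p : Pt d × Pt d => (p.1, u • p.1 + p.2)) (g := F)
      hFm.aestronglyMeasurable hsm.aemeasurable).2 hFi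
    rw [map_shear_eq_withDensity, integrable_withDensity_iff_integrable_smul' (by fun_prop)
      (Eventually.of_forall fun _ => ENNReal.ofReal_lt_top)] at h1
    refine h1.congr (Eventually.of_forall fun p => ?_)
    simp only [smul_eq_mul]
    rw [ENNReal.toReal_ofReal (gaussianDensity_pos _ one_pos _).le]
  change ∫ p, F (p.1, u • p.1 + p.2) ∂(ν.prod (stdGaussian (Pt d))) = 0
  rw [e1, integral_prod_symm _ hi2]
  refine integral_eq_zero_of_ae (Eventually.of_forall fun w => ?_)
  simp only [hF, Pi.zero_apply]
  by_cases hAw : A w = 0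
  · simp [hAw]
  have hZ := integrable_gaussianDensity_smul (ν := ν) u w
  have hN := integrable_gaussianDensity_smul_smul hν u w
  have e2 : ∀ z, gaussianDensity (u • z) 1 w * A w (h w - z) =
      A w (gaussianDensity (u • z) 1 w • f u w - gaussianDensity (u • z) 1 w • z) := fun z => by
    rw [← smul_sub, map_smul, smul_eq_mul, hfh w hAw]
  simp_rw [e2]
  rw [(A w).integral_comp_comm (φ := fun z => gaussianDensity (u • z) 1 w • f u w -
    gaussianDensity (u • z) 1 w • z) ((hZ.smul_const _).sub hN),
    integral_sub (hZ.smul_const _) hN, integral_smul_const, hf u w, sub_self, map_zero]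

section Step

variable {f : ℝ → Pt d → Pt d} {K B : ℝ} (hf : IsTameField f) (hBL : IsBoundedLipschitzField f K B)
include hBL

/-- The position at time `τ` of the curve that starts from `w - δ z` at time `τ - δ`, to first
order in `δ`. -/
lemma norm_flow_step_le (τ : ℝ) (w z : Pt d) {δ : ℝ} (hδ : 0 ≤ δ) :
    ‖flow hf (τ - δ) (w - δ • z) τ - w‖ ≤ δ * (B + ‖z‖) ∧
    ‖flow hf (τ - δ) (w - δ • z) τ - w - δ • (f τ w - z)‖ ≤
      K * (δ + δ * (B + ‖z‖)) * δ := by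
  set U := flow hf (τ - δ) (w - δ • z) with hU
  have hU0 : U (τ - δ) = w - δ • z := flow_self hf _ _
  have hUd : IsIntegralCurve U f := isIntegralCurve_flow hf _ _
  have h1 : ∀ u ∈ Icc (τ - δ) τ, ‖U u - w‖ ≤ δ * (B + ‖z‖) := fun u hu => by
    have h2 := norm_image_sub_le_of_norm_deriv_le_segment' (f := U) (C := B)
      (fun v _ => (hUd v).hasDerivWithinAt) (fun v _ => hBL.bound _ _) u hu
    have h3 : ‖U (τ - δ) - w‖ = δ * ‖z‖ := by
      rw [hU0, sub_sub_cancel_left, norm_neg, norm_smul, Real.norm_of_nonneg hδ]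
    have h4 : B * (u - (τ - δ)) ≤ B * δ :=
      mul_le_mul_of_nonneg_left (by linarith [hu.2]) hBL.nonneg_B
    have h5 := norm_add_le (U u - U (τ - δ)) (U (τ - δ) - w)
    rw [sub_add_sub_cancel] at h5
    linarith
  have hτ : τ ∈ Icc (τ - δ) τ := ⟨by linarith, le_rfl⟩
  refine ⟨h1 τ hτ, ?_⟩
  have h2 := norm_image_sub_le_of_norm_deriv_le_segment' (f := fun u => U u - u • f τ w)
    (f' := fun u => f u (U u) - f τ w) (a := τ - δ) (b := τ) (C := K * (δ + δ * (B + ‖z‖)))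
    (fun v _ => by
      simpa using ((hUd v).fun_sub ((hasDerivAt_id v).smul_const (f τ w))).hasDerivWithinAt)
    (fun v hv => (hBL.lipschitz _ _ _ _).trans (by
      have h3 : |v - τ| ≤ δ := abs_le.2 ⟨by linarith [hv.1], by linarith [hv.2]⟩
      exact mul_le_mul_of_nonneg_left (add_le_add h3 (h1 v (Ico_subset_Icc_self hv)))
        hBL.nonneg_K)) τ hτ
  rw [sub_sub_cancel] at h2
  refine le_of_eq_of_le (congrArg _ ?_) h2
  rw [hU0]
  module

lemma hasDerivWithinAt_flow_step (τ : ℝ) (w z : Pt d) :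
    HasDerivWithinAt (fun δ => flow hf (τ - δ) (w - δ • z) τ) (f τ w - z) (Ici 0) 0 := by
  rw [hasDerivWithinAt_iff_tendsto]
  have hlim : Tendsto (fun δ : ℝ => K * (δ + δ * (B + ‖z‖))) (𝓝[Ici 0] 0) (𝓝 0) := by
    have : Continuous fun δ : ℝ => K * (δ + δ * (B + ‖z‖)) := by fun_prop
    simpa using (this.tendsto 0).mono_left nhdsWithin_le_nhds
  refine squeeze_zero' (Eventually.of_forall fun _ => by positivity) ?_ hlim
  filter_upwards [self_mem_nhdsWithin] with δ (hδ : 0 ≤ δ)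
  have h := (norm_flow_step_le hf hBL τ w z hδ).2
  simp only [sub_zero, zero_smul, flow_self]
  rw [Real.norm_of_nonneg hδ]
  rcases hδ.eq_or_lt with rfl | hδ'
  · simp
  · rwa [inv_mul_le_iff₀ hδ', mul_comm]

end Step

/-- The transport of the Gaussian law, along a test function `φ`, by a bounded Lipschitz field `h`
that agrees with the conditional mean `f` wherever the support of `φ` can be reached. The
expectation of `φ` at the end point of the curve of `h` that starts at time `T - s` from
`(T - s) z + ε` has right derivative zero in `s`: the end point gives a Lipschitz function `ψ` of the
position at time `T - s`, hence one that is differentiable at almost every position, and the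
derivative of the expectation is that of `Dψ (h - z)`, which vanishes by orthogonality. -/
lemma integral_flow_eq_integral_shear {ν : Measure (Pt d)} [IsProbabilityMeasure ν]
    (hν : Integrable (fun z => z) ν) {f h : ℝ → Pt d → Pt d} (hfm : IsPosteriorMean ν f)
    {K B : ℝ} (hh : IsTameField h) (hBL : IsBoundedLipschitzField h K B) {T R : ℝ} (hT : 0 ≤ T)
    (hfh : ∀ u ∈ Icc 0 T, ∀ w, ‖w‖ ≤ R → h u w = f u w)
    {φ : Pt d → ℝ} {L : ℝ≥0} (hφ : LipschitzWith L φ)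
    (hφR : ∀ u ∈ Icc 0 T, ∀ w, R < ‖w‖ → φ (flow hh u w T) = 0) :
    ∫ w, φ (flow hh 0 w T) ∂(stdGaussian (Pt d)) =
      ∫ p, φ (T • p.1 + p.2) ∂(ν.prod (stdGaussian (Pt d))) := by
  set P := ν.prod (stdGaussian (Pt d)) with hP
  -- the position at time `T`, starting at time `τ` from `τ z + ε`
  set ψ : ℝ → Pt d → ℝ := fun τ w => φ (flow hh τ w T) with hψ
  have hψL : ∀ τ ∈ Icc 0 T, ∀ w z, |ψ τ w - ψ τ z| ≤ L * Real.exp (K * T) * ‖w - z‖ :=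
    fun τ hτ w z => by
      have h1 := hφ.dist_le_mul (flow hh τ w T) (flow hh τ z T)
      rw [Real.dist_eq, dist_eq_norm] at h1
      have h2 := norm_flow_sub_le hh hBL τ T w z
      have h3 : Real.exp (K * |T - τ|) ≤ Real.exp (K * T) := by
        have := hBL.nonneg_K
        gcongr
        exact abs_le.2 ⟨by linarith [hτ.2], by linarith [hτ.1]⟩
      calc |ψ τ w - ψ τ z| ≤ L * ‖flow hh τ w T - flow hh τ z T‖ := h1
        _ ≤ L * (‖w - z‖ * Real.exp (K * |T - τ|)) := by gcongr
        _ ≤ L * (‖w - z‖ * Real.exp (K * T)) := by gcongr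
        _ = _ := by ring
  set M : ℝ := L * Real.exp (K * T) with hM
  have hM0 : 0 ≤ M := by positivity
  have hψc : ∀ τ, Continuous (ψ τ) := fun τ => hφ.continuous.comp (continuous_flow_space hh τ T)
  set G : ℝ → ℝ := fun s => ∫ p, ψ (T - s) ((T - s) • p.1 + p.2) ∂P with hG
  have hbi : Integrable (fun p : Pt d × Pt d => M * (B + ‖p.1‖)) P :=
    (((integrable_const B).add hν.norm).const_mul M).comp_fst _
  -- a step of length `δ` back in time
  have hstep : ∀ s δ : ℝ, ∀ p : Pt d × Pt d, ψ (T - (s + δ)) ((T - (s + δ)) • p.1 + p.2) =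
      ψ (T - s) (flow hh (T - s - δ) ((T - s) • p.1 + p.2 - δ • p.1) (T - s)) := fun s δ p => by
    simp only [hψ]
    rw [flow_flow, ← sub_sub]
    congr 2
    module
  have hstepL : ∀ s δ : ℝ, T - s ∈ Icc 0 T → 0 ≤ δ → ∀ p : Pt d × Pt d,
      |ψ (T - (s + δ)) ((T - (s + δ)) • p.1 + p.2) - ψ (T - s) ((T - s) • p.1 + p.2)| ≤
        M * (B + ‖p.1‖) * δ := fun s δ hs hδ p => by
    rw [hstep]
    refine (hψL _ hs _ _).trans ?_
    rw [mul_assoc M, mul_comm (B + _) δ]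
    exact mul_le_mul_of_nonneg_left (norm_flow_step_le hh hBL _ _ _ hδ).1 hM0
  -- integrability, since `φ` has bounded support
  have hφi : ∀ s ∈ Icc 0 T, Integrable (fun p : Pt d × Pt d =>
      ψ (T - s) ((T - s) • p.1 + p.2)) P := fun s hs => by
    have hs' : T - s ∈ Icc 0 T := ⟨by linarith [hs.2], by linarith [hs.1]⟩
    obtain ⟨C, hC⟩ := (isCompact_closedBall (0 : Pt d) R).exists_bound_of_continuousOn
      (hψc (T - s)).continuousOn
    refine Integrable.of_bound (((hψc (T - s)).comp (by fun_prop)).aestronglyMeasurable)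
      (max C 0) (Eventually.of_forall fun p => ?_)
    by_cases hR : ‖(T - s) • p.1 + p.2‖ ≤ R
    · exact (hC _ (by simpa using hR)).trans (le_max_left _ _)
    · rw [hψ]
      simp only
      rw [hφR _ hs' _ (not_le.1 hR), norm_zero]
      exact le_max_right _ _
  have hGdiff : ∀ s δ : ℝ, s ∈ Icc 0 T → s + δ ∈ Icc 0 T → G (s + δ) - G s =
      ∫ p, (ψ (T - (s + δ)) ((T - (s + δ)) • p.1 + p.2) - ψ (T - s) ((T - s) • p.1 + p.2)) ∂P :=
    fun s δ hs hδ => (integral_sub (hφi _ hδ) (hφi _ hs)).symm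
  have hGle : ∀ s δ : ℝ, s ∈ Icc 0 T → 0 ≤ δ → s + δ ∈ Icc 0 T →
      |G (s + δ) - G s| ≤ (∫ p, M * (B + ‖p.1‖) ∂P) * δ := fun s δ hs hδ hsδ => by
    have hs' : T - s ∈ Icc 0 T := ⟨by linarith [hs.2], by linarith [hs.1]⟩
    rw [hGdiff s δ hs hsδ, ← integral_mul_const, ← Real.norm_eq_abs]
    exact norm_integral_le_of_norm_le (hbi.mul_const δ) (Eventually.of_forall fun p =>
      hstepL s δ hs' hδ p)
  have hGcont : ContinuousOn G (Icc 0 T) := by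
    refine (LipschitzOnWith.of_dist_le_mul (K := (∫ p, M * (B + ‖p.1‖) ∂P).toNNReal)
      fun a ha b hb => ?_).continuousOn
    have hI0 : 0 ≤ ∫ p, M * (B + ‖p.1‖) ∂P := integral_nonneg fun p => by
      have := hBL.nonneg_B
      positivity
    rw [Real.coe_toNNReal _ hI0]
    rcases le_total a b with hab | hab
    · have := hGle a (b - a) ha (by linarith) (by simpa using hb)
      rw [add_sub_cancel] at this
      rwa [dist_comm, Real.dist_eq, dist_comm a b, Real.dist_eq, abs_of_nonneg (sub_nonneg.2 hab)]
    · have := hGle b (a - b) hb (by linarith) (by simpa using ha)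
      rw [add_sub_cancel] at this
      rwa [Real.dist_eq, Real.dist_eq, abs_of_nonneg (sub_nonneg.2 hab)]
  have hGderiv : ∀ s ∈ Ico 0 T, HasDerivWithinAt G 0 (Ici s) s := fun s hs => by
    have hsI : s ∈ Icc 0 T := Ico_subset_Icc_self hs
    set τ := T - s with hτ
    have hτI : τ ∈ Icc 0 T := ⟨by linarith [hs.2], by linarith [hs.1]⟩
    have hLip : LipschitzWith M.toNNReal (ψ τ) := LipschitzWith.of_dist_le_mul fun w z => by
      rw [Real.coe_toNNReal _ hM0, Real.dist_eq, dist_eq_norm]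
      exact hψL τ hτI w z
    have hae : ∀ᵐ p ∂P, DifferentiableAt ℝ (ψ τ) (τ • p.1 + p.2) :=
      ae_shear τ hLip.ae_differentiableAt
    have hzero : ∫ p, fderiv ℝ (ψ τ) (τ • p.1 + p.2) (h τ (τ • p.1 + p.2) - p.1) ∂P = 0 := by
      refine integral_posteriorMean_orthogonal hν hfm τ (measurable_fderiv ℝ _)
        (L := M) (fun w => ?_) ?_ (B := B) (fun w => hBL.bound τ w) fun w hw => ?_
      · simpa [Real.coe_toNNReal _ hM0] using norm_fderiv_le_of_lipschitz ℝ hLip (x₀ := w)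
      · exact (hBL.continuous.comp (Continuous.prodMk_right τ)).measurable
      · refine hfh τ hτI w (not_lt.1 fun hR => hw ?_)
        -- outside the ball of radius `R` the function `ψ τ` vanishes identically
        have h0 : ψ τ =ᶠ[𝓝 w] fun _ => 0 := by
          filter_upwards [continuous_norm.continuousAt.eventually_const_lt hR] with y hy
          exact hφR τ hτI y hy
        rw [h0.fderiv_eq, fderiv_const_apply]
    rw [hasDerivWithinAt_iff_tendsto_slope, Ici_sdiff_left]
    have hmain : Tendsto (fun δ : ℝ => ∫ p, δ⁻¹ * (ψ (T - (s + δ)) ((T - (s + δ)) • p.1 + p.2) -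
        ψ τ (τ • p.1 + p.2)) ∂P) (𝓝[>] 0)
        (𝓝 (∫ p, fderiv ℝ (ψ τ) (τ • p.1 + p.2) (h τ (τ • p.1 + p.2) - p.1) ∂P)) := by
      refine tendsto_integral_filter_of_dominated_convergence
        (fun p : Pt d × Pt d => M * (B + ‖p.1‖)) (Eventually.of_forall fun δ => ?_) ?_ hbi ?_
      · exact (((hψc _).comp (by fun_prop)).sub ((hψc τ).comp (by fun_prop))).const_smul
          (δ⁻¹) |>.aestronglyMeasurable
      · filter_upwards [self_mem_nhdsWithin] with δ (hδ : 0 < δ)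
        refine Eventually.of_forall fun p => ?_
        rw [norm_mul, norm_inv, Real.norm_of_nonneg hδ.le, inv_mul_le_iff₀ hδ, mul_comm δ]
        exact hstepL s δ hτI hδ.le p
      · filter_upwards [hae] with p hp
        have h1 := hasDerivWithinAt_flow_step hh hBL τ (τ • p.1 + p.2) p.1
        have h2 : HasFDerivAt (ψ τ) (fderiv ℝ (ψ τ) (τ • p.1 + p.2))
            (flow hh (τ - 0) (τ • p.1 + p.2 - (0 : ℝ) • p.1) τ) := by
          rw [zero_smul, sub_zero, sub_zero, flow_self]
          exact hp.hasFDerivAt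
        have h3 := h2.comp_hasDerivWithinAt (0 : ℝ) h1
        rw [hasDerivWithinAt_iff_tendsto_slope, Ici_sdiff_left] at h3
        refine h3.congr fun δ => ?_
        rw [slope_def_module, sub_zero, smul_eq_mul]
        simp only [Function.comp_apply, zero_smul, sub_zero, flow_self]
        rw [hstep]
    rw [hzero] at hmain
    have hshift : Tendsto (fun x : ℝ => x - s) (𝓝[>] s) (𝓝[>] 0) := by
      refine tendsto_nhdsWithin_iff.2 ⟨?_, ?_⟩
      · have : Continuous fun x : ℝ => x - s := by fun_prop
        simpa using (this.tendsto s).mono_left nhdsWithin_le_nhds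
      · filter_upwards [self_mem_nhdsWithin] with x hx
        exact sub_pos.2 (mem_Ioi.1 hx)
    refine (hmain.comp hshift).congr' ?_
    filter_upwards [Ioo_mem_nhdsGT hs.2] with x hx
    have hxI : s + (x - s) ∈ Icc 0 T := by
      rw [add_sub_cancel]
      exact ⟨hs.1.trans hx.1.le, hx.2.le⟩
    have := hGdiff s (x - s) hsI hxI
    rw [Function.comp_apply, integral_const_mul, ← this, add_sub_cancel, slope_def_module,
      smul_eq_mul]
  have hconst := constant_of_has_deriv_right_zero hGcont hGderiv T (right_mem_Icc.2 hT)
  have hG0 : G 0 = ∫ p, φ (T • p.1 + p.2) ∂P := by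
    simp only [hG, hψ, sub_zero, flow_self]
  have hGT : G T = ∫ w, φ (flow hh 0 w T) ∂(stdGaussian (Pt d)) := by
    simp only [hG, hψ, sub_self, zero_smul, zero_add]
    rw [hP, integral_fun_snd (f := fun w => φ (flow hh 0 w T))]
    simp
  rw [← hG0, ← hGT, hconst]

/-- The flow of the field of conditional means transports the standard Gaussian law to the law of
`T z + ε` at time `T`. -/
lemma map_flow_stdGaussian {ν : Measure (Pt d)} [IsProbabilityMeasure ν]
    (hν : Integrable (fun z => z) ν) {f : ℝ → Pt d → Pt d} (hf : IsTameField f)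
    (hfm : IsPosteriorMean ν f) {T : ℝ} (hT : 0 ≤ T) :
    (stdGaussian (Pt d)).map (fun w => flow hf 0 w T) =
      (ν.prod (stdGaussian (Pt d))).map (fun p => T • p.1 + p.2) := by
  have hfc := continuous_flow_space hf 0 T
  have : IsProbabilityMeasure ((stdGaussian (Pt d)).map (fun w => flow hf 0 w T)) :=
    Measure.isProbabilityMeasure_map hfc.measurable.aemeasurable
  have : IsProbabilityMeasure ((ν.prod (stdGaussian (Pt d))).map (fun p => T • p.1 + p.2)) :=
    Measure.isProbabilityMeasure_map (by fun_prop)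
  refine ext_of_forall_integral_lipschitz fun φ L r hφ hφr => ?_
  rw [integral_map hfc.measurable.aemeasurable hφ.continuous.aestronglyMeasurable,
    integral_map (by fun_prop) hφ.continuous.aestronglyMeasurable]
  obtain ⟨C, hC, htr⟩ := hf.exists_truncation T hT
  have hfC : ∀ u w, |u| ≤ T → ‖f u w‖ ≤ C * (1 + ‖w‖) := fun u w hu => by
    obtain ⟨h, K, B, -, hg, heq⟩ := htr ‖w‖
    rw [← heq u w hu le_rfl]
    exact hg u w
  -- curves that end in the support of `φ` start in the ball of radius `R₁`, and curves that start
  -- there stay in the ball of radius `R`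
  set R₁ := (1 + |r|) * Real.exp (C * T) with hR₁
  set R := (1 + R₁) * Real.exp (C * T) with hR
  have hR₁0 : 0 ≤ R₁ := by positivity
  have hexp : 1 ≤ Real.exp (C * T) := Real.one_le_exp (by positivity)
  have hR₁R : R₁ ≤ R := by rw [hR]; nlinarith
  obtain ⟨h, K, B, hBL, hg, heq⟩ := htr R
  have hh := hBL.isTameField
  have habs : ∀ u ∈ Icc 0 T, |u| ≤ T := fun u hu => by rw [abs_of_nonneg hu.1]; exact hu.2
  have hback : ∀ (k : ℝ → Pt d → Pt d) (hk : IsTameField k),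
      (∀ u ∈ Icc 0 T, ∀ w, ‖k u w‖ ≤ C * (1 + ‖w‖)) →
      ∀ u ∈ Icc 0 T, ∀ w, R₁ < ‖w‖ → φ (flow hk u w T) = 0 := fun k hk hkC u hu w hw => by
    refine hφr _ (not_le.1 fun hle => hw.not_ge ?_)
    have hsub : uIcc T u ⊆ Icc 0 T := ordConnected_Icc.uIcc_subset ⟨hT, le_rfl⟩ hu
    have := norm_curve_le hC (a := T) (b := u) (fun v _ => isIntegralCurve_flow hk u w v)
      (fun v hv => hkC v (hsub hv))
    rw [flow_self] at this
    refine this.trans (mul_le_mul (add_le_add_right (hle.trans (le_abs_self r)) 1)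
      (Real.exp_le_exp.2 (mul_le_mul_of_nonneg_left ?_ hC.le)) (by positivity) (by positivity))
    exact abs_le.2 ⟨by linarith [hu.1], by linarith [hu.2]⟩
  have hbackh := hback h hh fun u _ w => hg u w
  have hbackf := hback f hf fun u hu w => hfC u w (habs u hu)
  rw [← integral_flow_eq_integral_shear hν hfm hh hBL hT
    (fun u hu w hw => heq u w (habs u hu) hw) hφ
    (fun u hu w hw => hbackh u hu w (hR₁R.trans_lt hw))]
  refine integral_congr_ae (Eventually.of_forall fun w => ?_)
  simp only
  rcases lt_or_ge R₁ ‖w‖ with hw | hw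
  · rw [hbackh 0 ⟨le_rfl, hT⟩ w hw, hbackf 0 ⟨le_rfl, hT⟩ w hw]
  · congr 1
    refine hf.curve_unique_uIcc (a := 0) (b := T) (fun u _ => isIntegralCurve_flow hf 0 w u)
      (fun u hu => ?_) ((flow_self hf 0 w).trans (flow_self hh 0 w).symm)
    rw [uIcc_of_le hT] at hu
    rw [← heq u _ (habs u hu)]
    · exact isIntegralCurve_flow hh 0 w u
    · have := norm_curve_le hC (a := 0) (b := u) (fun v _ => isIntegralCurve_flow hh 0 w v)
        (fun v _ => hg v)
      rw [flow_self] at this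
      refine this.trans (mul_le_mul (add_le_add_right hw 1)
        (Real.exp_le_exp.2 (mul_le_mul_of_nonneg_left ?_ hC.le)) (by positivity) (by positivity))
      rw [sub_zero]
      exact habs u hu

end Law

/-! ### Asymptotic velocity of the curves -/

section LongTime

variable {d : ℕ}

lemma IsTameField.continuous {E : Type*} [NormedAddCommGroup E] [NormedSpace ℝ E] {f : ℝ → E → E}
    (hf : IsTameField f) : Continuous (Function.uncurry f) := by
  refine continuous_iff_continuousAt.2 fun p => ?_
  obtain ⟨K, hK, hl⟩ := hf.lipschitz (|p.1| + 1) (‖p.2‖ + 1)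
  rw [ContinuousAt, tendsto_iff_norm_sub_tendsto_zero]
  have hlim : Tendsto (fun q : ℝ × E => K * (|q.1 - p.1| + ‖q.2 - p.2‖)) (𝓝 p) (𝓝 0) := by
    have : Continuous fun q : ℝ × E => K * (|q.1 - p.1| + ‖q.2 - p.2‖) := by fun_prop
    simpa using this.tendsto p
  refine squeeze_zero' (Eventually.of_forall fun _ => norm_nonneg _) ?_ hlim
  have h1 : ∀ᶠ q : ℝ × E in 𝓝 p, |q.1| < |p.1| + 1 :=
    (by fun_prop : Continuous fun q : ℝ × E => |q.1|).continuousAt.eventually_lt_const (by simp)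
  have h2 : ∀ᶠ q : ℝ × E in 𝓝 p, ‖q.2‖ < ‖p.2‖ + 1 :=
    (by fun_prop : Continuous fun q : ℝ × E => ‖q.2‖).continuousAt.eventually_lt_const (by simp)
  filter_upwards [h1, h2] with q hq1 hq2
  exact hl _ _ _ _ hq1.le (by simp) hq2.le (by simp)

lemma lintegral_shear (ν : Measure (Pt d)) [IsFiniteMeasure ν] (u : ℝ) {F : Pt d × Pt d → ℝ≥0∞}
    (hF : Measurable F) :
    ∫⁻ p, F (p.1, u • p.1 + p.2) ∂(ν.prod (stdGaussian (Pt d))) =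
      ∫⁻ w, ∫⁻ z, ENNReal.ofReal (gaussianDensity (u • z) 1 w) * F (z, w) ∂ν := by
  have hsm : Measurable fun p : Pt d × Pt d => (p.1, u • p.1 + p.2) := by fun_prop
  rw [← lintegral_map hF hsm, map_shear_eq_withDensity,
    lintegral_withDensity_eq_lintegral_mul _ (by fun_prop) hF,
    lintegral_prod_symm _ (by fun_prop)]
  rfl

lemma lintegral_enorm_stdGaussian_lt_top : ∫⁻ ε, ‖ε‖ₑ ∂(stdGaussian (Pt d)) < ∞ :=
  (IsGaussian.integrable_id (μ := stdGaussian (Pt d))).2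

variable {ν : Measure (Pt d)} [IsProbabilityMeasure ν] (hν : Integrable (fun z => z) ν)
  {f : ℝ → Pt d → Pt d} (hf : IsTameField f) (hfm : IsPosteriorMean ν f)

include hν hf hfm

/-- By Jensen's inequality for the conditional mean, the expected distance between the conditional
mean and the rescaled position `u⁻¹ (u z + ε) = z + u⁻¹ ε` is at most the mean of `u⁻¹ ‖ε‖`. -/
lemma lintegral_posteriorMean_sub_le {u : ℝ} (hu : 0 < u) :
    ∫⁻ w, ‖f u (flow hf 0 w u) - u⁻¹ • flow hf 0 w u‖ₑ ∂(stdGaussian (Pt d)) ≤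
      ENNReal.ofReal u⁻¹ * ∫⁻ ε, ‖ε‖ₑ ∂(stdGaussian (Pt d)) := by
  have hfu : Measurable (f u) := (hf.continuous.comp (Continuous.prodMk_right u)).measurable
  have hH : Measurable fun w => ‖f u w - u⁻¹ • w‖ₑ := by fun_prop
  have e1 : ∫⁻ w, ‖f u (flow hf 0 w u) - u⁻¹ • flow hf 0 w u‖ₑ ∂(stdGaussian (Pt d)) =
      ∫⁻ p, ‖f u (u • p.1 + p.2) - u⁻¹ • (u • p.1 + p.2)‖ₑ ∂(ν.prod (stdGaussian (Pt d))) := by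
    rw [← lintegral_map hH (continuous_flow_space hf 0 u).measurable,
      map_flow_stdGaussian hν hf hfm hu.le, lintegral_map hH (by fun_prop)]
  have e2 : ∫⁻ p, ‖p.1 - u⁻¹ • (u • p.1 + p.2)‖ₑ ∂(ν.prod (stdGaussian (Pt d))) =
      ENNReal.ofReal u⁻¹ * ∫⁻ ε, ‖ε‖ₑ ∂(stdGaussian (Pt d)) := by
    have : ∀ p : Pt d × Pt d, ‖p.1 - u⁻¹ • (u • p.1 + p.2)‖ₑ = ENNReal.ofReal u⁻¹ * ‖p.2‖ₑ :=
      fun p => by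
        rw [smul_add, inv_smul_smul₀ hu.ne', sub_add_cancel_left, enorm_neg, enorm_smul,
          Real.enorm_of_nonneg (by positivity)]
    simp_rw [this]
    rw [lintegral_prod _ (by fun_prop)]
    simp [lintegral_const_mul _ measurable_enorm]
  rw [e1, ← e2, lintegral_shear ν u (F := fun p => ‖f u p.2 - u⁻¹ • p.2‖ₑ) (by fun_prop),
    lintegral_shear ν u (F := fun p => ‖p.1 - u⁻¹ • p.2‖ₑ) (by fun_prop)]
  refine lintegral_mono fun w => ?_
  have hZ := integrable_gaussianDensity_smul (ν := ν) u w
  have hN := integrable_gaussianDensity_smul_smul hν u w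
  have h1 : ∫ z, gaussianDensity (u • z) 1 w • (z - u⁻¹ • w) ∂ν =
      (∫ z, gaussianDensity (u • z) 1 w ∂ν) • (f u w - u⁻¹ • w) := by
    simp_rw [smul_sub]
    rw [integral_sub hN (hZ.smul_const _), integral_smul_const, ← hfm u w]
  have h2 : ∀ z, ‖gaussianDensity (u • z) 1 w • (z - u⁻¹ • w)‖ₑ =
      ENNReal.ofReal (gaussianDensity (u • z) 1 w) * ‖z - u⁻¹ • w‖ₑ := fun z => by
    rw [enorm_smul, Real.enorm_of_nonneg (gaussianDensity_pos _ one_pos _).le]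
  simp only
  rw [lintegral_mul_const _ (by fun_prop), ← ofReal_integral_eq_lintegral_ofReal hZ
    (Eventually.of_forall fun z => (gaussianDensity_pos _ one_pos _).le),
    ← Real.enorm_of_nonneg (integral_nonneg fun z => (gaussianDensity_pos _ one_pos _).le),
    ← enorm_smul, ← h1]
  refine (enorm_integral_le_lintegral_enorm _).trans (le_of_eq ?_)
  simp_rw [h2]

/-- The rescaled curves `u⁻¹ W u` have almost surely finite length, hence a limit at infinity. -/
lemma ae_exists_tendsto_flow_div :
    ∀ᵐ w ∂(stdGaussian (Pt d)), ∃ l, Tendsto (fun u : ℝ => u⁻¹ • flow hf 0 w u) atTop (𝓝 l) := by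
  set γ := stdGaussian (Pt d) with hγ
  have hflow : Measurable fun p : Pt d × ℝ => flow hf 0 p.1 p.2 := by
    have h1 := stronglyMeasurable_uncurry_of_continuous_of_stronglyMeasurable
      (u := fun (u : ℝ) (w : Pt d) => flow hf 0 w u) (fun w => continuous_flow_time hf 0 w)
      (fun u => (continuous_flow_space hf 0 u).stronglyMeasurable)
    exact h1.measurable.comp measurable_swap
  -- the derivative of the rescaled curve
  set V : Pt d → ℝ → Pt d := fun w u =>
    u⁻¹ • (f u (flow hf 0 w u) - u⁻¹ • flow hf 0 w u) with hV
  have hVm : Measurable fun p : Pt d × ℝ => V p.1 p.2 := by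
    have h1 : Measurable fun p : Pt d × ℝ => f p.2 (flow hf 0 p.1 p.2) :=
      hf.continuous.measurable.comp (measurable_snd.prodMk hflow)
    exact measurable_snd.inv.smul (h1.sub (measurable_snd.inv.smul hflow))
  have hVu : ∀ u ∈ Ioi (1 : ℝ), ∫⁻ w, ‖V w u‖ₑ ∂γ ≤
      ENNReal.ofReal (u ^ (-2 : ℝ)) * ∫⁻ ε, ‖ε‖ₑ ∂γ := fun u (hu : 1 < u) => by
    have hu0 : 0 < u := by linarith
    have h1 : ∀ w, ‖V w u‖ₑ =
        ENNReal.ofReal u⁻¹ * ‖f u (flow hf 0 w u) - u⁻¹ • flow hf 0 w u‖ₑ := fun w => by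
      simp only [hV]
      rw [enorm_smul, Real.enorm_of_nonneg (by positivity)]
    have h2 : u ^ (-2 : ℝ) = u⁻¹ * u⁻¹ := by
      rw [Real.rpow_neg hu0.le, Real.rpow_two, pow_two, mul_inv]
    simp_rw [h1]
    rw [lintegral_const_mul' _ _ ENNReal.ofReal_ne_top, h2, ENNReal.ofReal_mul (by positivity),
      mul_assoc]
    gcongr
    exact lintegral_posteriorMean_sub_le hν hf hfm hu0
  have hfin : ∫⁻ w, (∫⁻ u in Ioi (1 : ℝ), ‖V w u‖ₑ) ∂γ < ∞ := by
    rw [lintegral_lintegral_swap hVm.enorm.aemeasurable]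
    calc ∫⁻ u in Ioi (1 : ℝ), (∫⁻ w, ‖V w u‖ₑ ∂γ)
        ≤ ∫⁻ u in Ioi (1 : ℝ), (ENNReal.ofReal (u ^ (-2 : ℝ)) * ∫⁻ ε, ‖ε‖ₑ ∂γ) :=
          setLIntegral_mono' measurableSet_Ioi hVu
      _ = (∫⁻ u in Ioi (1 : ℝ), ENNReal.ofReal (u ^ (-2 : ℝ))) * ∫⁻ ε, ‖ε‖ₑ ∂γ :=
          lintegral_mul_const _ (by fun_prop)
      _ < ∞ := ENNReal.mul_lt_top
          (((integrableOn_Ioi_rpow_of_lt (by norm_num) one_pos).lintegral_lt_top))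
          lintegral_enorm_stdGaussian_lt_top
  have hae := ae_lt_top (Measurable.lintegral_prod_right' hVm.enorm) hfin.ne
  filter_upwards [hae] with w hw
  refine ⟨_, tendsto_limUnder_of_hasDerivAt_of_integrableOn_Ioi (a := 1) (f' := V w)
    (fun u (hu : 1 < u) => ?_) ⟨(hVm.comp measurable_prodMk_left).aestronglyMeasurable, hw⟩⟩
  have hu0 : u ≠ 0 := by linarith
  have h1 := (hasDerivAt_inv hu0).fun_smul (isIntegralCurve_flow hf 0 w u)
  refine h1.congr_deriv ?_
  simp only [hV]
  rw [smul_sub, smul_smul, sub_eq_add_neg, ← neg_smul, ← mul_inv, pow_two]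

/-- The law of the limit at infinity of the rescaled curves is `ν`: at time `u` their law is that of
`z + u⁻¹ ε`. -/
lemma map_lim_flow_div {V : Pt d → Pt d}
    (hV : ∀ᵐ w ∂(stdGaussian (Pt d)), Tendsto (fun u : ℝ => u⁻¹ • flow hf 0 w u) atTop (𝓝 (V w))) :
    AEMeasurable V (stdGaussian (Pt d)) ∧ (stdGaussian (Pt d)).map V = ν := by
  have hcont : ∀ u : ℝ, Continuous fun w => u⁻¹ • flow hf 0 w u := fun u => by
    have := continuous_flow_space hf 0 u
    fun_prop
  have hVn : ∀ᵐ w ∂(stdGaussian (Pt d)),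
      Tendsto (fun n : ℕ => (n : ℝ)⁻¹ • flow hf 0 w n) atTop (𝓝 (V w)) := by
    filter_upwards [hV] with w hw using hw.comp tendsto_natCast_atTop_atTop
  have hVm : AEMeasurable V (stdGaussian (Pt d)) :=
    aemeasurable_of_tendsto_metrizable_ae (f := fun (n : ℕ) w => (n : ℝ)⁻¹ • flow hf 0 w n) atTop
      (fun n => (hcont n).measurable.aemeasurable) hVn
  refine ⟨hVm, ?_⟩
  have : IsProbabilityMeasure ((stdGaussian (Pt d)).map V) := Measure.isProbabilityMeasure_map hVm
  refine ext_of_forall_integral_eq_of_IsFiniteMeasure fun φ => ?_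
  rw [integral_map hVm φ.continuous.aestronglyMeasurable]
  have h1 : Tendsto (fun n : ℕ => ∫ w, φ ((n : ℝ)⁻¹ • flow hf 0 w n) ∂(stdGaussian (Pt d))) atTop
      (𝓝 (∫ w, φ (V w) ∂(stdGaussian (Pt d)))) := by
    refine tendsto_integral_of_dominated_convergence (fun _ => ‖φ‖)
      (fun n => (φ.continuous.comp (hcont n)).aestronglyMeasurable) (integrable_const _)
      (fun n => Eventually.of_forall fun w => φ.norm_coe_le_norm _) ?_
    filter_upwards [hVn] with w hw using (φ.continuous.tendsto _).comp hw
  have h2 : Tendsto (fun n : ℕ => ∫ p, φ ((n : ℝ)⁻¹ • ((n : ℝ) • p.1 + p.2))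
      ∂(ν.prod (stdGaussian (Pt d)))) atTop (𝓝 (∫ p, φ p.1 ∂(ν.prod (stdGaussian (Pt d))))) := by
    refine tendsto_integral_of_dominated_convergence (fun _ => ‖φ‖)
      (fun n => (φ.continuous.comp (by fun_prop)).aestronglyMeasurable) (integrable_const _)
      (fun n => Eventually.of_forall fun w => φ.norm_coe_le_norm _)
      (Eventually.of_forall fun p => (φ.continuous.tendsto _).comp ?_)
    have h3 : Tendsto (fun n : ℕ => p.1 + (n : ℝ)⁻¹ • p.2) atTop (𝓝 (p.1 + (0 : ℝ) • p.2)) :=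
      tendsto_const_nhds.add (tendsto_inv_atTop_nhds_zero_nat.smul_const _)
    rw [zero_smul, add_zero] at h3
    refine h3.congr' ?_
    filter_upwards [eventually_gt_atTop 0] with n hn
    rw [smul_add, inv_smul_smul₀ (by positivity)]
  have h4 : ∫ p, φ p.1 ∂(ν.prod (stdGaussian (Pt d))) = ∫ z, φ z ∂ν := by
    rw [integral_fun_fst (f := fun z => φ z)]
    simp
  rw [h4] at h2
  refine tendsto_nhds_unique h1 (h2.congr fun n => ?_)
  have hφn : Continuous fun w => φ ((n : ℝ)⁻¹ • w) := φ.continuous.comp (by fun_prop)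
  rw [← integral_map (f := fun w => φ ((n : ℝ)⁻¹ • w)) (φ := fun w => flow hf 0 w n)
    (continuous_flow_space hf 0 n).measurable.aemeasurable hφn.aestronglyMeasurable,
    map_flow_stdGaussian hν hf hfm (Nat.cast_nonneg n),
    integral_map (by fun_prop) hφn.aestronglyMeasurable]

end LongTime

/-! ### Schedulers -/

section Scheduler

variable {α σ : ℝ → ℝ}

lemma IsScheduler.α_pos (h : IsScheduler α σ) {s : ℝ} (hs : s ∈ Ioc 0 1) : 0 < α s := by
  have := h.strictMonoOn_α ⟨le_rfl, zero_le_one⟩ (Ioc_subset_Icc_self hs) hs.1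
  rwa [h.α_zero] at this

lemma IsScheduler.σ_pos (h : IsScheduler α σ) {s : ℝ} (hs : s ∈ Ico 0 1) : 0 < σ s := by
  have := h.strictAntiOn_σ (Ico_subset_Icc_self hs) ⟨zero_le_one, le_rfl⟩ hs.2
  rwa [h.σ_one] at this

lemma IsScheduler.σ_nonneg (h : IsScheduler α σ) {s : ℝ} (hs : s ∈ Icc 0 1) : 0 ≤ σ s := by
  have := h.strictAntiOn_σ.antitoneOn hs ⟨zero_le_one, le_rfl⟩ hs.2
  rwa [h.σ_one] at this

lemma IsScheduler.α_nonneg (h : IsScheduler α σ) {s : ℝ} (hs : s ∈ Icc 0 1) : 0 ≤ α s := by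
  have := h.strictMonoOn_α.monotoneOn ⟨le_rfl, zero_le_one⟩ hs hs.1
  rwa [h.α_zero] at this

lemma IsScheduler.g_lt (h : IsScheduler α σ) {s t : ℝ} (hs : s ∈ Ioc 0 1) (ht : t ∈ Ioc 0 1)
    (hst : s < t) : g α σ t < g α σ s := by
  have h1 := h.strictMonoOn_α (Ioc_subset_Icc_self hs) (Ioc_subset_Icc_self ht) hst
  have h2 := h.strictAntiOn_σ (Ioc_subset_Icc_self hs) (Ioc_subset_Icc_self ht) hst
  have h3 := h.α_pos hs
  have h4 := h.σ_nonneg (Ioc_subset_Icc_self ht)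
  unfold g
  gcongr

lemma IsScheduler.injOn_g (h : IsScheduler α σ) : InjOn (g α σ) (Ioc 0 1) :=
  StrictAntiOn.injOn fun _ hs _ ht hst => h.g_lt hs ht hst

lemma IsScheduler.exists_g_eq (h : IsScheduler α σ) {y : ℝ} (hy : 0 ≤ y) :
    ∃ s ∈ Ioc (0 : ℝ) 1, g α σ s = y := by
  have hc : ContinuousOn (fun s => σ s ^ 2 - y * α s ^ 2) (Icc 0 1) :=
    (h.continuousOn_σ.pow 2).sub (continuousOn_const.mul (h.continuousOn_α.pow 2))
  obtain ⟨s, hs, hs0⟩ := intermediate_value_Icc' zero_le_one hc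
    (show (0 : ℝ) ∈ Icc _ _ by simp [h.σ_zero, h.σ_one, h.α_zero, h.α_one, hy])
  have hs1 : s ≠ 0 := by
    rintro rfl
    simp [h.σ_zero, h.α_zero] at hs0
  have hs' : s ∈ Ioc (0 : ℝ) 1 := ⟨lt_of_le_of_ne hs.1 hs1.symm, hs.2⟩
  refine ⟨s, hs', ?_⟩
  have := h.α_pos hs'
  rw [g, div_eq_iff (by positivity)]
  simp only at hs0
  linarith

lemma IsScheduler.gInv_mem (h : IsScheduler α σ) {y : ℝ} (hy : 0 ≤ y) :
    gInv α σ y ∈ Ioc (0 : ℝ) 1 := Function.invFunOn_mem (h.exists_g_eq hy)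

lemma IsScheduler.g_gInv (h : IsScheduler α σ) {y : ℝ} (hy : 0 ≤ y) : g α σ (gInv α σ y) = y :=
  Function.invFunOn_eq (h.exists_g_eq hy)

lemma IsScheduler.gInv_g (h : IsScheduler α σ) {s : ℝ} (hs : s ∈ Ioc (0 : ℝ) 1) :
    gInv α σ (g α σ s) = s :=
  have hg : 0 ≤ g α σ s := by unfold g; positivity
  h.injOn_g (h.gInv_mem hg) hs (h.g_gInv hg)

lemma IsScheduler.rStar_arg_nonneg (h : IsScheduler α σ) {t t' : ℝ} (ht : 0 < t) (htt' : t < t')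
    (ht' : t' ≤ 1) : 0 ≤ g α σ t * g α σ t' / (g α σ t - g α σ t') := by
  have h1 := h.g_lt ⟨ht, htt'.le.trans ht'⟩ ⟨ht.trans htt', ht'⟩ htt'
  have h2 : 0 ≤ g α σ t' := by unfold g; positivity
  have h3 : 0 ≤ g α σ t := by unfold g; positivity
  exact div_nonneg (mul_nonneg h3 h2) (sub_nonneg.2 h1.le)

lemma IsScheduler.rStar_mem (h : IsScheduler α σ) {t t' : ℝ} (ht : 0 < t) (htt' : t < t')
    (ht' : t' ≤ 1) : rStar α σ t t' ∈ Ioc (0 : ℝ) 1 := h.gInv_mem (h.rStar_arg_nonneg ht htt' ht')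

lemma IsScheduler.g_rStar (h : IsScheduler α σ) {t t' : ℝ} (ht : 0 < t) (htt' : t < t')
    (ht' : t' ≤ 1) : g α σ (rStar α σ t t') = g α σ t * g α σ t' / (g α σ t - g α σ t') :=
  h.g_gInv (h.rStar_arg_nonneg ht htt' ht')

/-- The argument of `g⁻¹` in the definition of `t*(s, t)` is `g(t) g(s) / (g(t) + g(s))`; at
`s = r*` it is `g(t')`. -/
lemma IsScheduler.tStar_arg_rStar (h : IsScheduler α σ) {t t' : ℝ} (ht : 0 < t) (htt' : t < t')
    (ht' : t' ≤ 1) :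
    σ t ^ 2 * σ (rStar α σ t t') ^ 2 /
      (σ t ^ 2 * α (rStar α σ t t') ^ 2 + α t ^ 2 * σ (rStar α σ t t') ^ 2) = g α σ t' := by
  have h1 := h.g_lt ⟨ht, htt'.le.trans ht'⟩ ⟨ht.trans htt', ht'⟩ htt'
  have h2 : 0 ≤ g α σ t' := by unfold g; positivity
  have hr := h.g_rStar ht htt' ht'
  have hrm := h.rStar_mem ht htt' ht'
  have hαr := h.α_pos hrm
  have hαt := h.α_pos ⟨ht, htt'.le.trans ht'⟩
  have hσr : σ (rStar α σ t t') ^ 2 = g α σ (rStar α σ t t') * α (rStar α σ t t') ^ 2 := by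
    rw [g, div_mul_cancel₀ _ (by positivity)]
  have hσt : σ t ^ 2 = g α σ t * α t ^ 2 := by
    rw [g, div_mul_cancel₀ _ (by positivity)]
  rw [hσr, hσt, hr]
  have h3 : g α σ t - g α σ t' ≠ 0 := (sub_pos.2 h1).ne'
  have h4 : g α σ t ≠ 0 := (h2.trans_lt h1).ne'
  have h5 : g α σ t * α t ^ 2 * α (rStar α σ t t') ^ 2 +
      α t ^ 2 * (g α σ t * g α σ t' / (g α σ t - g α σ t') * α (rStar α σ t t') ^ 2) =
      α t ^ 2 * α (rStar α σ t t') ^ 2 * (g α σ t ^ 2 / (g α σ t - g α σ t')) := by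
    field_simp
    ring
  rw [h5]
  field_simp

lemma IsScheduler.tStar_rStar (h : IsScheduler α σ) {t t' : ℝ} (ht : 0 < t) (htt' : t < t')
    (ht' : t' ≤ 1) : tStar α σ (rStar α σ t t') t = t' := by
  rw [tStar, h.tStar_arg_rStar ht htt' ht', h.gInv_g ⟨ht.trans htt', ht'⟩]

lemma IsScheduler.hasDerivAt_α (h : IsScheduler α σ) {s : ℝ} (hs : s ∈ Ioo 0 1) :
    HasDerivAt α (deriv α s) s :=
  (h.differentiableOn_α.differentiableAt (Ioo_mem_nhds hs.1 hs.2)).hasDerivAt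

lemma IsScheduler.hasDerivAt_σ (h : IsScheduler α σ) {s : ℝ} (hs : s ∈ Ioo 0 1) :
    HasDerivAt σ (deriv σ s) s :=
  (h.differentiableOn_σ.differentiableAt (Ioo_mem_nhds hs.1 hs.2)).hasDerivAt

lemma IsScheduler.deriv_α_nonneg (h : IsScheduler α σ) {s : ℝ} (hs : s ∈ Ioo 0 1) :
    0 ≤ deriv α s := by
  rw [← derivWithin_of_mem_nhds (Icc_mem_nhds hs.1 hs.2)]
  exact h.strictMonoOn_α.monotoneOn.derivWithin_nonneg

lemma IsScheduler.deriv_σ_nonpos (h : IsScheduler α σ) {s : ℝ} (hs : s ∈ Ioo 0 1) :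
    deriv σ s ≤ 0 := by
  rw [← derivWithin_of_mem_nhds (Icc_mem_nhds hs.1 hs.2)]
  exact h.strictAntiOn_σ.antitoneOn.derivWithin_nonpos

/-- The derivative of the new time variable `α / σ`. -/
noncomputable def ratioDeriv (α σ : ℝ → ℝ) (s : ℝ) : ℝ :=
  (deriv α s * σ s - α s * deriv σ s) / σ s ^ 2

lemma IsScheduler.hasDerivAt_ratio (h : IsScheduler α σ) {s : ℝ} (hs : s ∈ Ioo 0 1) :
    HasDerivAt (fun u => α u / σ u) (ratioDeriv α σ s) s :=
  (h.hasDerivAt_α hs).fun_div (h.hasDerivAt_σ hs) (h.σ_pos (Ioo_subset_Ico_self hs)).ne'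

lemma IsScheduler.ratioDeriv_nonneg (h : IsScheduler α σ) {s : ℝ} (hs : s ∈ Ioo 0 1) :
    0 ≤ ratioDeriv α σ s := by
  have h1 := h.deriv_α_nonneg hs
  have h2 := h.deriv_σ_nonpos hs
  have h3 := h.α_nonneg (Ioo_subset_Icc_self hs)
  have h4 := h.σ_nonneg (Ioo_subset_Icc_self hs)
  unfold ratioDeriv
  refine div_nonneg ?_ (by positivity)
  nlinarith [mul_nonneg h1 h4, mul_nonneg h3 (neg_nonneg.2 h2)]

lemma IsScheduler.continuousOn_ratio (h : IsScheduler α σ) :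
    ContinuousOn (fun u => α u / σ u) (Ico 0 1) :=
  (h.continuousOn_α.mono Ico_subset_Icc_self).div (h.continuousOn_σ.mono Ico_subset_Icc_self)
    fun _ hs => (h.σ_pos hs).ne'

lemma IsScheduler.tendsto_ratio (h : IsScheduler α σ) :
    Tendsto (fun u => α u / σ u) (𝓝[Ico 0 1] 1) atTop := by
  have h1 : Tendsto α (𝓝[Ico 0 1] 1) (𝓝 1) := by
    have := (h.continuousOn_α 1 ⟨zero_le_one, le_rfl⟩).mono Ico_subset_Icc_self
    rwa [ContinuousWithinAt, h.α_one] at this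
  have h2 : Tendsto σ (𝓝[Ico 0 1] 1) (𝓝[>] 0) := by
    refine tendsto_nhdsWithin_iff.2 ⟨?_, ?_⟩
    · have := (h.continuousOn_σ 1 ⟨zero_le_one, le_rfl⟩).mono Ico_subset_Icc_self
      rwa [ContinuousWithinAt, h.σ_one] at this
    · filter_upwards [self_mem_nhdsWithin] with u hu using h.σ_pos hu
  exact h1.pos_mul_atTop one_pos (tendsto_inv_nhdsGT_zero.comp h2)

end Scheduler

/-! ### The posterior and the GLASS velocity field as exponential tilts -/

section Posterior

open scoped RealInnerProductSpace

variable {d : ℕ} {α σ : ℝ → ℝ} (pdata : Measure (Pt d))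
  [IsProbabilityMeasure pdata]

lemma marginalDensity_eq {t : ℝ} (hσ : 0 < σ t) (x : Pt d) :
    marginalDensity α σ pdata t x = gaussianDensity 0 (σ t ^ 2) x *
      tiltPartition pdata ((α t / σ t ^ 2) • x) (α t ^ 2 / σ t ^ 2) := by
  unfold marginalDensity tiltPartition
  simp_rw [gaussianDensity_smul_eq (α t) (pow_pos hσ 2).ne' x]
  rw [integral_const_mul]

lemma marginalDensity_pos {t : ℝ} (hα : 0 < α t) (hσ : 0 < σ t) (x : Pt d) :
    0 < marginalDensity α σ pdata t x := by
  rw [marginalDensity_eq pdata hσ]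
  exact mul_pos (gaussianDensity_pos _ (by positivity) _) (tiltPartition_pos pdata _ (by positivity))

/-- The posterior is an exponential tilt of the data distribution. -/
lemma posterior_density_eq {t : ℝ} (hσ : 0 < σ t) (x z : Pt d) :
    gaussianDensity (α t • z) (σ t ^ 2) x / marginalDensity α σ pdata t x =
      (tiltPartition pdata ((α t / σ t ^ 2) • x) (α t ^ 2 / σ t ^ 2))⁻¹ *
        tiltWeight ((α t / σ t ^ 2) • x) (α t ^ 2 / σ t ^ 2) z := by
  rw [marginalDensity_eq pdata hσ, gaussianDensity_smul_eq (α t) (pow_pos hσ 2).ne' x,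
    mul_div_mul_left _ _ (gaussianDensity_pos _ (by positivity) _).ne', div_eq_inv_mul]

lemma posterior_density_nonneg {t : ℝ} (hα : 0 < α t) (hσ : 0 < σ t) (x z : Pt d) :
    0 ≤ gaussianDensity (α t • z) (σ t ^ 2) x / marginalDensity α σ pdata t x :=
  div_nonneg (gaussianDensity_pos _ (by positivity) _).le (marginalDensity_pos pdata hα hσ x).le

lemma integral_posterior {F : Type*} [NormedAddCommGroup F] [NormedSpace ℝ F] {t : ℝ}
    (hα : 0 < α t) (hσ : 0 < σ t) (x : Pt d) (φ : Pt d → F) :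
    ∫ z, φ z ∂(posterior α σ pdata t x) =
      (tiltPartition pdata ((α t / σ t ^ 2) • x) (α t ^ 2 / σ t ^ 2))⁻¹ •
        ∫ z, tiltWeight ((α t / σ t ^ 2) • x) (α t ^ 2 / σ t ^ 2) z • φ z ∂pdata := by
  rw [posterior, integral_withDensity_eq_integral_toReal_smul (by fun_prop)
    (Eventually.of_forall fun _ => ENNReal.ofReal_lt_top), ← integral_smul]
  refine integral_congr_ae (Eventually.of_forall fun z => ?_)
  simp only
  rw [ENNReal.toReal_ofReal (posterior_density_nonneg pdata hα hσ x z),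
    posterior_density_eq pdata hσ, mul_smul]

lemma denoiser_eq_tiltMean {t : ℝ} (hα : 0 < α t) (hσ : 0 < σ t) (x : Pt d) :
    denoiser α σ pdata t x = tiltMean pdata ((α t / σ t ^ 2) • x) (α t ^ 2 / σ t ^ 2) :=
  integral_posterior pdata hα hσ x fun z => z

lemma integrable_posterior_density {t : ℝ} (hα : 0 < α t) (hσ : 0 < σ t) (x : Pt d) :
    Integrable (fun z => gaussianDensity (α t • z) (σ t ^ 2) x / marginalDensity α σ pdata t x)
      pdata := by
  simp_rw [posterior_density_eq pdata hσ]
  exact (integrable_tiltWeight pdata _ (by positivity)).const_mul _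

lemma isProbabilityMeasure_posterior {t : ℝ} (hα : 0 < α t) (hσ : 0 < σ t) (x : Pt d) :
    IsProbabilityMeasure (posterior α σ pdata t x) := by
  refine ⟨?_⟩
  rw [posterior, withDensity_apply _ MeasurableSet.univ, Measure.restrict_univ,
    ← ofReal_integral_eq_lintegral_ofReal (integrable_posterior_density pdata hα hσ x)
    (Eventually.of_forall fun z => posterior_density_nonneg pdata hα hσ x z), integral_div]
  have : ∫ z, gaussianDensity (α t • z) (σ t ^ 2) x ∂pdata = marginalDensity α σ pdata t x := rfl
  rw [this, div_self (marginalDensity_pos pdata hα hσ x).ne', ENNReal.ofReal_one]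

lemma integrable_id_posterior {t : ℝ} (hα : 0 < α t) (hσ : 0 < σ t) (x : Pt d) :
    Integrable (fun z => z) (posterior α σ pdata t x) := by
  rw [posterior, integrable_withDensity_iff_integrable_smul' (by fun_prop)
    (Eventually.of_forall fun _ => ENNReal.ofReal_lt_top)]
  refine ((integrable_tiltWeight_smul pdata ((α t / σ t ^ 2) • x)
    (a := α t ^ 2 / σ t ^ 2) (by positivity)).smul (tiltPartition pdata ((α t / σ t ^ 2) • x)
    (α t ^ 2 / σ t ^ 2))⁻¹).congr (Eventually.of_forall fun z => ?_)
  simp only [Pi.smul_apply]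
  rw [ENNReal.toReal_ofReal (posterior_density_nonneg pdata hα hσ x z),
    posterior_density_eq pdata hσ, mul_smul]

/-- The velocity of the GLASS posterior ODE in the variables `w = x̄ / σ` and `u = α / σ`. -/
noncomputable def glassDrift (α σ : ℝ → ℝ) (pdata : Measure (Pt d)) (t : ℝ) (x : Pt d) :
    ℝ → Pt d → Pt d :=
  tiltField pdata ((α t / σ t ^ 2) • x) (α t ^ 2 / σ t ^ 2)

lemma isTameField_glassDrift {t : ℝ} (hα : 0 < α t) (hσ : 0 < σ t) (x : Pt d) :
    IsTameField (glassDrift α σ pdata t x) :=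
  isTameField_tiltField pdata _ (by positivity)

/-- Tilts compose: tilting the posterior by the observation `u z + ε = w` adds the parameters. -/
lemma isPosteriorMean_glassDrift {t : ℝ} (hα : 0 < α t) (hσ : 0 < σ t) (x : Pt d) :
    IsPosteriorMean (posterior α σ pdata t x) (glassDrift α σ pdata t x) := by
  intro u w
  set b₀ := (α t / σ t ^ 2) • x with hb
  set a₀ := α t ^ 2 / σ t ^ 2 with ha
  have ha₀ : 0 < a₀ := by positivity
  have hprod : ∀ z, tiltWeight b₀ a₀ z * gaussianDensity (u • z) 1 w =
      gaussianDensity 0 1 w * tiltWeight (u • w + b₀) (u ^ 2 + a₀) z := fun z => by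
    rw [gaussianDensity_smul_eq u one_ne_zero w z, mul_left_comm, tiltWeight, tiltWeight,
      tiltWeight, ← Real.exp_add, inner_add_left]
    congr 2
    rw [div_one, div_one]
    ring
  have hu : 0 < u ^ 2 + a₀ := by positivity
  rw [integral_posterior pdata hα hσ x, integral_posterior pdata hα hσ x, ← hb, ← ha]
  simp_rw [smul_smul, hprod, smul_eq_mul, hprod, mul_smul]
  rw [integral_const_mul, integral_smul, mul_smul]
  congr 2
  exact tiltPartition_smul_tiltMean pdata _ hu

/-- In the variables `w = x̄ / σ` and `u = α / σ` the GLASS velocity field is `glassDrift`. -/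
lemma IsScheduler.glassField_eq (hS : IsScheduler α σ) {t : ℝ} (ht : t ∈ Ioo 0 1) (x : Pt d)
    {s : ℝ} (hs : s ∈ Ioo 0 1) (y : Pt d) :
    glassField α σ pdata t x s y = (deriv σ s / σ s) • y +
      (deriv α s - α s * (deriv σ s / σ s)) •
        glassDrift α σ pdata t x (α s / σ s) ((σ s)⁻¹ • y) := by
  have hαt := hS.α_pos (Ioo_subset_Ioc_self ht)
  have hσt := hS.σ_pos (Ioo_subset_Ico_self ht)
  have hαs := hS.α_pos (Ioo_subset_Ioc_self hs)
  have hσs := hS.σ_pos (Ioo_subset_Ico_self hs)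
  set D := σ t ^ 2 * α s ^ 2 + α t ^ 2 * σ s ^ 2 with hD
  have hD0 : 0 < D := by positivity
  have harg : 0 < σ t ^ 2 * σ s ^ 2 / D := by positivity
  set τ := tStar α σ s t with hτ
  have hτm : τ ∈ Ioc (0 : ℝ) 1 := hS.gInv_mem harg.le
  have hgτ : g α σ τ = σ t ^ 2 * σ s ^ 2 / D := hS.g_gInv harg.le
  have hατ := hS.α_pos hτm
  -- `g 1 = 0`, while `g τ > 0`; the density in the denoiser needs `σ τ > 0`
  have hτ1 : τ ≠ 1 := fun h1 => by
    rw [h1, g, hS.σ_one] at hgτ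
    norm_num at hgτ
    exact harg.ne hgτ
  have hστ := hS.σ_pos ⟨hτm.1.le, lt_of_le_of_ne hτm.2 hτ1⟩
  have hinv : α τ ^ 2 / σ τ ^ 2 = D / (σ t ^ 2 * σ s ^ 2) := by
    rw [← inv_div, ← inv_div _ D, ← hgτ, g]
  unfold glassField
  rw [denoiser_eq_tiltMean pdata hατ hστ, glassDrift, tiltField]
  have h2 : α τ ^ 2 / σ τ ^ 2 = (α s / σ s) ^ 2 + α t ^ 2 / σ t ^ 2 := by
    rw [hinv, hD]
    field_simp
  have h1 : (α τ / σ τ ^ 2) • α τ • suffStat α σ s t y x =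
      (α s / σ s) • (σ s)⁻¹ • y + (α t / σ t ^ 2) • x := by
    rw [smul_smul, div_mul_eq_mul_div, ← pow_two, hinv, suffStat, ← hD, smul_smul, smul_add,
      smul_smul, smul_smul, smul_smul]
    congr 2 <;> field_simp
  rw [h1, h2]

end Posterior

/-! ### Trajectories of the GLASS posterior ODE -/

section Trajectories

variable {d : ℕ} {α σ : ℝ → ℝ} (hS : IsScheduler α σ) (pdata : Measure (Pt d))
  [IsProbabilityMeasure pdata] {t : ℝ} (ht : t ∈ Ioo 0 1) (x : Pt d)

include hS ht

/-- A rescaled trajectory `w = y / σ` is a curve of `glassDrift` in the time variable `α / σ`. -/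
lemma IsGlassTrajectory.hasDerivAt_div {s r : ℝ} (hs : 0 ≤ s) (hr : r ≤ 1) {y : ℝ → Pt d}
    (hy : IsGlassTrajectory α σ pdata t x s r y) {u : ℝ} (hu : u ∈ Ioo s r) :
    HasDerivAt (fun u => (σ u)⁻¹ • y u)
      (ratioDeriv α σ u • glassDrift α σ pdata t x (α u / σ u) ((σ u)⁻¹ • y u)) u := by
  have hu' : u ∈ Ioo (0 : ℝ) 1 := ⟨hs.trans_lt hu.1, hu.2.trans_le hr⟩
  have hσ := hS.σ_pos (Ioo_subset_Ico_self hu')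
  have h1 := ((hS.hasDerivAt_σ hu').fun_inv hσ.ne').fun_smul (hy.2 u hu)
  refine h1.congr_deriv ?_
  rw [hS.glassField_eq pdata ht x hu', ratioDeriv, smul_add, smul_smul, smul_smul,
    add_right_comm, ← add_smul]
  have h2 : (σ u)⁻¹ * (deriv σ u / σ u) + -deriv σ u / σ u ^ 2 = 0 := by
    field_simp
    ring
  rw [h2, zero_smul, zero_add]
  congr 1
  field_simp

lemma hasDerivAt_smul_curve {W : ℝ → Pt d}
    (hW : ∀ u, HasDerivAt W (glassDrift α σ pdata t x u (W u)) u) {u : ℝ} (hu : u ∈ Ioo 0 1) :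
    HasDerivAt (fun u => σ u • W (α u / σ u))
      (glassField α σ pdata t x u (σ u • W (α u / σ u))) u := by
  have hσ := hS.σ_pos (Ioo_subset_Ico_self hu)
  have h1 := (hS.hasDerivAt_σ hu).fun_smul
    ((hW (α u / σ u)).scomp u (hS.hasDerivAt_ratio hu))
  refine h1.congr_deriv ?_
  rw [hS.glassField_eq pdata ht x hu, ratioDeriv, inv_smul_smul₀ hσ.ne', smul_smul, smul_smul,
    div_mul_cancel₀ _ hσ.ne', add_comm, Function.comp_apply]
  congr 2
  field_simp

/-- Two trajectories that agree at the start agree as long as the equation is regular, that is,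
before time `1`. -/
lemma IsGlassTrajectory.eq_of_lt_one {s q : ℝ} (hs : 0 ≤ s) (hsq : s ≤ q) (hq : q < 1)
    {y₁ y₂ : ℝ → Pt d} (h₁ : IsGlassTrajectory α σ pdata t x s q y₁)
    (h₂ : IsGlassTrajectory α σ pdata t x s q y₂) (h₀ : y₁ s = y₂ s) : y₁ q = y₂ q := by
  have hf := isTameField_glassDrift pdata (hS.α_pos (Ioo_subset_Ioc_self ht))
    (hS.σ_pos (Ioo_subset_Ico_self ht)) x
  have hsub : Icc s q ⊆ Ico 0 1 := fun u hu => ⟨hs.trans hu.1, hu.2.trans_lt hq⟩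
  have hσinv : ContinuousOn (fun u => (σ u)⁻¹) (Icc s q) :=
    ContinuousOn.inv₀ (hS.continuousOn_σ.mono (hsub.trans Ico_subset_Icc_self))
      fun u hu => (hS.σ_pos (hsub hu)).ne'
  have hρ : ContinuousOn (fun u => α u / σ u) (Icc s q) := hS.continuousOn_ratio.mono hsub
  set w₁ : ℝ → Pt d := fun u => (σ u)⁻¹ • y₁ u with hw₁
  set w₂ : ℝ → Pt d := fun u => (σ u)⁻¹ • y₂ u with hw₂
  have hc₁ : ContinuousOn w₁ (Icc s q) := hσinv.smul h₁.1
  have hc₂ : ContinuousOn w₂ (Icc s q) := hσinv.smul h₂.1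
  obtain ⟨R₁, hR₁⟩ := isCompact_Icc.exists_bound_of_continuousOn hc₁
  obtain ⟨R₂, hR₂⟩ := isCompact_Icc.exists_bound_of_continuousOn hc₂
  obtain ⟨N, hN⟩ := isCompact_Icc.exists_bound_of_continuousOn hρ
  obtain ⟨K, hK, hl⟩ := hf.lipschitz N (max R₁ R₂)
  set f := glassDrift α σ pdata t x with hf_def
  -- Grönwall's argument in the time variable `α / σ`.
  set e : ℝ → ℝ := fun u => ‖w₁ u - w₂ u‖ ^ 2 * Real.exp (-(2 * K) * (α u / σ u)) with he
  have hec : ContinuousOn e (Icc s q) :=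
    ((hc₁.sub hc₂).norm.pow 2).mul ((hρ.const_mul _).rexp)
  have hed : ∀ u ∈ Ioo s q, ∃ e', HasDerivAt e e' u ∧ e' ≤ 0 := fun u hu => by
    have hu' := Ioo_subset_Icc_self hu
    have hu01 : u ∈ Ioo (0 : ℝ) 1 := ⟨hs.trans_lt hu.1, hu.2.trans hq⟩
    have hd := ((h₁.hasDerivAt_div hS pdata ht x hs hq.le hu).sub
      (h₂.hasDerivAt_div hS pdata ht x hs hq.le hu)).norm_sq
    refine ⟨_, hd.mul (((hS.hasDerivAt_ratio hu01).const_mul (-(2 * K))).exp), ?_⟩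
    have hρ' := hS.ratioDeriv_nonneg hu01
    have hlip := hl (α u / σ u) (α u / σ u) (w₁ u) (w₂ u) (hN u hu') (hN u hu')
      ((hR₁ u hu').trans (le_max_left _ _)) ((hR₂ u hu').trans (le_max_right _ _))
    rw [sub_self, abs_zero, zero_add] at hlip
    have hin := (real_inner_le_norm (w₁ u - w₂ u)
      (f (α u / σ u) (w₁ u) - f (α u / σ u) (w₂ u))).trans
      (mul_le_mul_of_nonneg_left hlip (norm_nonneg _))
    rw [← hf_def, ← smul_sub, real_inner_smul_right]
    have hex := (Real.exp_pos (-(2 * K) * (α u / σ u))).le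
    have := mul_nonneg (mul_nonneg hρ' hex) (sub_nonneg.2 hin)
    simp only [hw₁, hw₂, Pi.sub_apply] at this ⊢
    linarith
  have hanti : AntitoneOn e (Icc s q) := by
    refine antitoneOn_of_deriv_nonpos (convex_Icc s q) hec ?_ ?_ <;> rw [interior_Icc]
    · intro u hu
      obtain ⟨e', h, -⟩ := hed u hu
      exact h.differentiableAt.differentiableWithinAt
    · intro u hu
      obtain ⟨e', h, h'⟩ := hed u hu
      rwa [h.deriv]
  have heq : e q ≤ e s := hanti ⟨le_rfl, hsq⟩ ⟨hsq, le_rfl⟩ hsq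
  have hes : e s = 0 := by simp [he, hw₁, hw₂, h₀]
  have hw : w₁ q = w₂ q := by
    by_contra hne
    have : 0 < ‖w₁ q - w₂ q‖ := norm_pos_iff.2 (sub_ne_zero.2 hne)
    have h3 : 0 < e q := by positivity
    linarith
  exact smul_right_injective _ (inv_ne_zero (hS.σ_pos (hsub ⟨hsq, le_rfl⟩)).ne') hw

/-- Uniqueness of trajectories, up to and including time `1`. -/
lemma IsGlassTrajectory.eq_of_eq {s r : ℝ} (hs : 0 ≤ s) (hsr : s ≤ r) (hr : r ≤ 1)
    {y₁ y₂ : ℝ → Pt d} (h₁ : IsGlassTrajectory α σ pdata t x s r y₁)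
    (h₂ : IsGlassTrajectory α σ pdata t x s r y₂) (h₀ : y₁ s = y₂ s) : y₁ r = y₂ r := by
  rcases hsr.eq_or_lt with rfl | hlt
  · exact h₀
  have hsub : ∀ {y}, IsGlassTrajectory α σ pdata t x s r y → ∀ q ∈ Ico s r,
      IsGlassTrajectory α σ pdata t x s q y := fun h q hq =>
    ⟨h.1.mono (Icc_subset_Icc_right hq.2.le), fun u hu => h.2 u ⟨hu.1, hu.2.trans hq.2⟩⟩
  have : (𝓝[Ico s r] r).NeBot := by
    rw [← mem_closure_iff_nhdsWithin_neBot, closure_Ico hlt.ne]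
    exact ⟨hsr, le_rfl⟩
  have hl : ∀ {y}, IsGlassTrajectory α σ pdata t x s r y → Tendsto y (𝓝[Ico s r] r) (𝓝 (y r)) :=
    fun h => (h.1 r ⟨hsr, le_rfl⟩).mono_left (nhdsWithin_mono _ Ico_subset_Icc_self)
  refine tendsto_nhds_unique ((hl h₁).congr' ?_) (hl h₂)
  filter_upwards [self_mem_nhdsWithin] with q hq
  exact (hsub h₁ q hq).eq_of_lt_one hS pdata ht x hs hq.1 (hq.2.trans_le hr) (hsub h₂ q hq) h₀

lemma IsGlassTrajectory.diamondMap_eq {s r : ℝ} (hs : 0 ≤ s) (hsr : s ≤ r) (hr : r ≤ 1)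
    {y : ℝ → Pt d} (hy : IsGlassTrajectory α σ pdata t x s r y) :
    diamondMap α σ pdata t x s r (y s) = y r := by
  have h : ∃ z : ℝ → Pt d, IsGlassTrajectory α σ pdata t x s r z ∧ z s = y s := ⟨y, hy, rfl⟩
  rw [diamondMap, dif_pos h]
  exact h.choose_spec.1.eq_of_eq hS pdata ht x hs hsr hr hy h.choose_spec.2

/-- Before time `1` trajectories are rescaled integral curves of `glassDrift`. -/
lemma isGlassTrajectory_smul_curve {W : ℝ → Pt d}
    (hW : ∀ u, HasDerivAt W (glassDrift α σ pdata t x u (W u)) u) {r : ℝ} (hr : r < 1) :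
    IsGlassTrajectory α σ pdata t x 0 r fun u => σ u • W (α u / σ u) := by
  have hsub : Icc 0 r ⊆ Ico 0 1 := fun u hu => ⟨hu.1, hu.2.trans_lt hr⟩
  have hWc : Continuous W := continuous_iff_continuousAt.2 fun u => (hW u).continuousAt
  exact ⟨(hS.continuousOn_σ.mono (hsub.trans Ico_subset_Icc_self)).smul
    (hWc.comp_continuousOn (hS.continuousOn_ratio.mono hsub)),
    fun u hu => hasDerivAt_smul_curve hS pdata ht x hW ⟨hu.1, hu.2.trans hr⟩⟩

/-- A rescaled integral curve of `glassDrift` extends to a trajectory up to time `1` if the curve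
has an asymptotic velocity, which then is its end point. -/
lemma isGlassTrajectory_one {W : ℝ → Pt d}
    (hW : ∀ u, HasDerivAt W (glassDrift α σ pdata t x u (W u)) u) {v : Pt d}
    (hv : Tendsto (fun u : ℝ => u⁻¹ • W u) atTop (𝓝 v)) :
    IsGlassTrajectory α σ pdata t x 0 1 fun u => if u < 1 then σ u • W (α u / σ u) else v := by
  have hWc : Continuous W := continuous_iff_continuousAt.2 fun u => (hW u).continuousAt
  have hc : ContinuousOn (fun u => σ u • W (α u / σ u)) (Ico 0 1) :=
    (hS.continuousOn_σ.mono Ico_subset_Icc_self).smul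
      (hWc.comp_continuousOn hS.continuousOn_ratio)
  have hcongr : ∀ u < 1, (fun u => if u < 1 then σ u • W (α u / σ u) else v) =ᶠ[𝓝 u]
      fun u => σ u • W (α u / σ u) := fun u hu => by
    filter_upwards [Iio_mem_nhds hu] with w hw using if_pos hw
  refine ⟨fun u hu => ?_, fun u hu => ?_⟩
  · rcases hu.2.eq_or_lt with rfl | hlt
    · rw [← Ico_union_right zero_le_one, continuousWithinAt_union]
      refine ⟨?_, continuousWithinAt_singleton⟩
      rw [ContinuousWithinAt, if_neg (lt_irrefl _)]
      have hα : Tendsto α (𝓝[Ico 0 1] 1) (𝓝 1) := by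
        have := (hS.continuousOn_α 1 ⟨zero_le_one, le_rfl⟩).mono Ico_subset_Icc_self
        rwa [ContinuousWithinAt, hS.α_one] at this
      -- `σ W(α / σ) = α (α / σ)⁻¹ W(α / σ)`
      have h1 := hα.smul (hv.comp hS.tendsto_ratio)
      rw [one_smul] at h1
      refine h1.congr' ?_
      have h0 : ∀ᶠ u : ℝ in 𝓝[Ico 0 1] 1, 0 < u :=
        mem_nhdsWithin_of_mem_nhds (Ioi_mem_nhds one_pos)
      filter_upwards [self_mem_nhdsWithin, h0] with u hu hu0
      have hα0 := hS.α_pos ⟨hu0, hu.2.le⟩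
      have hσ0 := hS.σ_pos hu
      rw [if_pos hu.2, Function.comp_apply, smul_smul]
      congr 1
      field_simp
    · have h1 : ContinuousWithinAt (fun u => σ u • W (α u / σ u)) (Icc 0 1) u := by
        have := hc u ⟨hu.1, hlt⟩
        rwa [← Ici_inter_Iio, continuousWithinAt_inter (Iio_mem_nhds hlt),
          ← continuousWithinAt_inter (Iic_mem_nhds hlt)] at this
      exact h1.congr_of_eventuallyEq (nhdsWithin_le_nhds (hcongr u hlt)) (if_pos hlt)
  · have h1 := hasDerivAt_smul_curve hS pdata ht x hW hu
    have h2 := (hcongr u hu.2).eq_of_nhds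
    rw [← h2] at h1
    exact h1.congr_of_eventuallyEq (hcongr u hu.2)

end Trajectories

/-! ### The law of the sample before time one -/

section Law

open scoped RealInnerProductSpace

/-- Bayes' rule for Gaussian densities: the law of `(z, x, y)` factors in the two ways
`p(x | z) p(y | x, z)` and `p(y | z) p(x | y)`. -/
lemma gaussianDensity_mul_gaussianDensity {d : ℕ} {a s A S T : ℝ} (hs : 0 < s) (hA : 0 < A)
    (hSp : 0 < S) (hT : 0 < T) (hT2 : T ^ 2 = A ^ 2 / S ^ 2 - a ^ 2 / s ^ 2) (x y z : Pt d) :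
    gaussianDensity (a • z) (s ^ 2) x *
        gaussianDensity ((S ^ 2 / A) • (T ^ 2 • z + (a / s ^ 2) • x)) ((S ^ 2 / A * T) ^ 2) y =
      gaussianDensity (A • z) (S ^ 2) y *
        gaussianDensity ((a / A) • y) (s ^ 2 - a ^ 2 / A ^ 2 * S ^ 2) x := by
  obtain ⟨M, hM⟩ : ∃ M, M = A ^ 2 * s ^ 2 - a ^ 2 * S ^ 2 := ⟨_, rfl⟩
  have hTM : T ^ 2 = M / (S ^ 2 * s ^ 2) := by rw [hT2, hM]; field_simp
  have hMp : 0 < M := by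
    have h1 : M = T ^ 2 * (S ^ 2 * s ^ 2) := by rw [hTM]; field_simp
    rw [h1]; positivity
  have hv : s ^ 2 - a ^ 2 / A ^ 2 * S ^ 2 = M / A ^ 2 := by rw [hM]; field_simp
  have hcT : (S ^ 2 / A * T) ^ 2 = S ^ 2 * M / (A ^ 2 * s ^ 2) := by
    rw [mul_pow, hTM]; field_simp
  rw [hv, hcT, hTM]
  unfold gaussianDensity
  have hsq : √(2 * Real.pi * s ^ 2) * √(2 * Real.pi * (S ^ 2 * M / (A ^ 2 * s ^ 2))) =
      √(2 * Real.pi * S ^ 2) * √(2 * Real.pi * (M / A ^ 2)) := by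
    rw [← Real.sqrt_mul (by positivity), ← Real.sqrt_mul (by positivity)]
    congr 1
    field_simp
  rw [mul_mul_mul_comm, mul_mul_mul_comm (√(2 * Real.pi * S ^ 2) ^ d)⁻¹, ← mul_inv, ← mul_inv,
    ← mul_pow _ _ d, ← mul_pow _ _ d, hsq, ← Real.exp_add, ← Real.exp_add]
  congr 2
  simp only [norm_sub_sq_real, norm_smul, norm_add_sq_real, mul_pow, Real.norm_eq_abs, sq_abs,
    inner_smul_left, inner_smul_right, inner_add_right,
    RCLike.conj_to_real, real_inner_comm x y, real_inner_comm x z]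
  field_simp
  rw [hM]
  ring

variable {d : ℕ} {α σ : ℝ → ℝ} (pdata : Measure (Pt d)) [IsProbabilityMeasure pdata]

lemma measurable_forwardDensity (t t' : ℝ) (x : Pt d) :
    Measurable (forwardDensity α σ t t' x) := by
  unfold forwardDensity gaussianDensity
  fun_prop

/-- The DDPM kernel is a mixture over the posterior of `z` of the conditional laws of `x_{t'}`
given `z` and `x_t`. -/
lemma ddpmKernel_eq_map {t t' T : ℝ} (hα : 0 < α t) (hσ : 0 < σ t) (hα' : 0 < α t')
    (hσ' : 0 < σ t') (hT : 0 < T) (hT2 : T ^ 2 = α t' ^ 2 / σ t' ^ 2 - α t ^ 2 / σ t ^ 2)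
    (x : Pt d) :
    ddpmKernel α σ pdata t t' x = ((posterior α σ pdata t x).prod (stdGaussian (Pt d))).map
      fun p => (σ t' ^ 2 / α t') • (T • (T • p.1 + p.2) + (α t / σ t ^ 2) • x) := by
  have := isProbabilityMeasure_posterior pdata hα hσ x
  refine Measure.ext_of_lintegral _ fun F hF => ?_
  have hfm := measurable_forwardDensity (α := α) (σ := σ) t t' x
  have hG : Measurable fun z : Pt d => ∫⁻ ε, F ((σ t' ^ 2 / α t') •
      (T • (T • z + ε) + (α t / σ t ^ 2) • x)) ∂(stdGaussian (Pt d)) :=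
    Measurable.lintegral_prod_right' (f := fun p : Pt d × Pt d => F ((σ t' ^ 2 / α t') •
      (T • (T • p.1 + p.2) + (α t / σ t ^ 2) • x))) (by fun_prop)
  rw [lintegral_map hF (by fun_prop), lintegral_prod _ (by fun_prop), ddpmKernel,
    lintegral_withDensity_eq_lintegral_mul _ (by fun_prop) hF, marginal,
    lintegral_map (by fun_prop) (by fun_prop), lintegral_prod _ (by fun_prop), posterior,
    lintegral_withDensity_eq_lintegral_mul _ (by fun_prop) hG]
  refine lintegral_congr fun z => ?_
  have h2 : ∀ ε : Pt d, (σ t' ^ 2 / α t') • (T • (T • z + ε) + (α t / σ t ^ 2) • x) =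
      (σ t' ^ 2 / α t') • (T ^ 2 • z + (α t / σ t ^ 2) • x) + (σ t' ^ 2 / α t' * T) • ε :=
    fun ε => by module
  simp only [Pi.mul_apply, h2]
  rw [lintegral_stdGaussian_affine _ hσ' (F := fun y =>
      ENNReal.ofReal (forwardDensity α σ t t' x y / marginalDensity α σ pdata t x) * F y)
      (by fun_prop),
    lintegral_stdGaussian_affine _ (by positivity) hF, ← lintegral_const_mul _ (by fun_prop)]
  refine lintegral_congr fun y => ?_
  rw [← mul_assoc, ← mul_assoc, ← ENNReal.ofReal_mul (gaussianDensity_pos _ (by positivity) _).le,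
    ← ENNReal.ofReal_mul (posterior_density_nonneg pdata hα hσ x z), ← mul_div_assoc,
    div_mul_eq_mul_div, gaussianDensity_mul_gaussianDensity hσ hα' hσ' hT hT2]
  rfl

variable (hS : IsScheduler α σ) {t t' : ℝ} (ht : 0 < t) (htt' : t < t') (x : Pt d)

include hS ht htt'

lemma rStar_lt_one (ht' : t' < 1) : rStar α σ t t' < 1 := by
  refine lt_of_le_of_ne (hS.rStar_mem ht htt' ht'.le).2 fun h => ?_
  have h1 := hS.g_rStar ht htt' ht'.le
  have h2 := hS.g_lt ⟨ht, (htt'.trans ht').le⟩ ⟨ht.trans htt', ht'.le⟩ htt'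
  have h3 : 0 < g α σ t' :=
    div_pos (pow_pos (hS.σ_pos ⟨(ht.trans htt').le, ht'⟩) 2)
      (pow_pos (hS.α_pos ⟨ht.trans htt', ht'.le⟩) 2)
  have h4 : g α σ (rStar α σ t t') = 0 := by simp [h, g, hS.σ_one]
  have h5 : 0 < g α σ t * g α σ t' / (g α σ t - g α σ t') :=
    div_pos (mul_pos (h3.trans h2) h3) (sub_pos.2 h2)
  linarith

/-- At `r = r*` the squared ratio `(α / σ)²` is the increment of `(α / σ)²` from `t` to `t'`. -/
lemma sq_ratio_rStar (ht' : t' < 1) :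
    (α (rStar α σ t t') / σ (rStar α σ t t')) ^ 2 =
      α t' ^ 2 / σ t' ^ 2 - α t ^ 2 / σ t ^ 2 := by
  have hα := hS.α_pos ⟨ht, (htt'.trans ht').le⟩
  have hσ := hS.σ_pos ⟨ht.le, htt'.trans ht'⟩
  have hα' := hS.α_pos ⟨ht.trans htt', ht'.le⟩
  have hσ' := hS.σ_pos ⟨(ht.trans htt').le, ht'⟩
  have hr := hS.rStar_mem ht htt' ht'.le
  have hαr := hS.α_pos hr
  have hσr := hS.σ_pos ⟨hr.1.le, rStar_lt_one hS ht htt' ht'⟩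
  have h := congrArg (·⁻¹) (hS.tStar_arg_rStar ht htt' ht'.le)
  simp only [g, inv_div] at h
  rw [← h]
  field_simp
  ring

/-- The sample is an affine function of the end point, at time `α / σ` of `r*`, of the curve of
`glassDrift` that starts from the inner noise. -/
lemma diamondSample_eq (ht' : t' < 1) (hf : IsTameField (glassDrift α σ pdata t x)) (w : Pt d) :
    diamondSample α σ pdata t t' x w = (σ t' ^ 2 / α t') •
      ((α (rStar α σ t t') / σ (rStar α σ t t')) •
        flow hf 0 w (α (rStar α σ t t') / σ (rStar α σ t t')) + (α t / σ t ^ 2) • x) := by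
  have hα := hS.α_pos ⟨ht, (htt'.trans ht').le⟩
  have hσ := hS.σ_pos ⟨ht.le, htt'.trans ht'⟩
  have hα' := hS.α_pos ⟨ht.trans htt', ht'.le⟩
  have hσ' := hS.σ_pos ⟨(ht.trans htt').le, ht'⟩
  have hr := hS.rStar_mem ht htt' ht'.le
  have hr1 := rStar_lt_one hS ht htt' ht'
  have hy := isGlassTrajectory_smul_curve hS pdata ⟨ht, htt'.trans ht'⟩ x
    (isIntegralCurve_flow hf 0 w) hr1
  have hX := hy.diamondMap_eq hS pdata ⟨ht, htt'.trans ht'⟩ x le_rfl hr.1.le hr.2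
  simp only [hS.α_zero, hS.σ_zero, zero_div, flow_self, one_smul] at hX
  have hg := hS.tStar_arg_rStar ht htt' ht'.le
  have hαr := hS.α_pos hr
  have hσr := hS.σ_pos ⟨hr.1.le, hr1⟩
  rw [diamondSample, hX, suffStat]
  generalize flow hf 0 w (α (rStar α σ t t') / σ (rStar α σ t t')) = W
  set r := rStar α σ t t'
  set D := σ t ^ 2 * α r ^ 2 + α t ^ 2 * σ r ^ 2 with hD
  have hD0 : 0 < D := by positivity
  have hc : α t' * D⁻¹ = σ t' ^ 2 / α t' / (σ t ^ 2 * σ r ^ 2) := by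
    rw [g, div_eq_div_iff (by positivity) (by positivity)] at hg
    field_simp
    linarith
  rw [smul_smul, hc, smul_add, smul_add, smul_smul, smul_smul, smul_smul, smul_smul, smul_smul]
  congr 2 <;> field_simp

lemma exists_isGlassTrajectory (ht' : t' < 1) (w : Pt d) :
    ∃ y : ℝ → Pt d, IsGlassTrajectory α σ pdata t x 0 (rStar α σ t t') y ∧ y 0 = w := by
  have hf := isTameField_glassDrift pdata (hS.α_pos ⟨ht, (htt'.trans ht').le⟩)
    (hS.σ_pos ⟨ht.le, htt'.trans ht'⟩) x
  refine ⟨_, isGlassTrajectory_smul_curve hS pdata ⟨ht, htt'.trans ht'⟩ x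
    (isIntegralCurve_flow hf 0 w) (rStar_lt_one hS ht htt' ht'), ?_⟩
  simp only [hS.α_zero, hS.σ_zero, zero_div, flow_self, one_smul]

lemma hasLaw_diamondSample_of_lt_one (ht' : t' < 1) :
    HasLaw (diamondSample α σ pdata t t' x) (ddpmKernel α σ pdata t t' x)
      (stdGaussian (Pt d)) := by
  have hα := hS.α_pos ⟨ht, (htt'.trans ht').le⟩
  have hσ := hS.σ_pos ⟨ht.le, htt'.trans ht'⟩
  have hα' := hS.α_pos ⟨ht.trans htt', ht'.le⟩
  have hσ' := hS.σ_pos ⟨(ht.trans htt').le, ht'⟩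
  have hr := hS.rStar_mem ht htt' ht'.le
  have hf := isTameField_glassDrift pdata hα hσ x
  have := isProbabilityMeasure_posterior pdata hα hσ x
  set T := α (rStar α σ t t') / σ (rStar α σ t t') with hTdef
  have hT : 0 < T :=
    div_pos (hS.α_pos hr) (hS.σ_pos ⟨hr.1.le, rStar_lt_one hS ht htt' ht'⟩)
  have hfun : diamondSample α σ pdata t t' x =
      (fun y => (σ t' ^ 2 / α t') • (T • y + (α t / σ t ^ 2) • x)) ∘ fun w => flow hf 0 w T :=
    funext fun w => diamondSample_eq pdata hS ht htt' x ht' hf w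
  have hflow : Measurable fun w => flow hf 0 w T := (continuous_flow_space hf 0 T).measurable
  rw [hfun]
  refine ⟨(Measurable.comp (by fun_prop) hflow).aemeasurable, ?_⟩
  rw [← Measure.map_map (by fun_prop) hflow,
    map_flow_stdGaussian (integrable_id_posterior pdata hα hσ x) hf
      (isPosteriorMean_glassDrift pdata hα hσ x) hT.le,
    Measure.map_map (by fun_prop) (by fun_prop),
    ddpmKernel_eq_map pdata hα hσ hα' hσ' hT (sq_ratio_rStar hS ht htt' ht')]
  rfl

end Law

/-! ### The law of the sample at time one -/

section TerminalTime

variable {d : ℕ} {α σ : ℝ → ℝ} (pdata : Measure (Pt d)) [IsProbabilityMeasure pdata]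
  (hS : IsScheduler α σ) {t : ℝ} (ht : t ∈ Ioo 0 1) (x : Pt d)

include hS

/-- There is no noise left at time `1`. -/
lemma ddpmKernel_one : ddpmKernel α σ pdata t 1 x = posterior α σ pdata t x := by
  have h1 : marginal α σ pdata 1 = pdata := by
    simp only [marginal, hS.α_one, hS.σ_one, one_smul, zero_smul, add_zero]
    exact Measure.fst_prod
  rw [ddpmKernel, posterior, h1]
  simp [forwardDensity, hS.α_one, hS.σ_one]

include ht

lemma rStar_one : rStar α σ t 1 = 1 := by
  refine hS.injOn_g (hS.rStar_mem ht.1 ht.2 le_rfl) ⟨one_pos, le_rfl⟩ ?_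
  rw [hS.g_rStar ht.1 ht.2 le_rfl]
  simp [g, hS.σ_one]

/-- Almost every trajectory reaches time `1`, and the end points have the posterior as their law. -/
lemma ae_exists_isGlassTrajectory_one : ∃ V : Pt d → Pt d,
    (∀ᵐ w ∂(stdGaussian (Pt d)),
      ∃ y, IsGlassTrajectory α σ pdata t x 0 1 y ∧ y 0 = w ∧ y 1 = V w) ∧
    AEMeasurable V (stdGaussian (Pt d)) ∧
    (stdGaussian (Pt d)).map V = posterior α σ pdata t x := by
  have hα := hS.α_pos (Ioo_subset_Ioc_self ht)
  have hσ := hS.σ_pos (Ioo_subset_Ico_self ht)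
  have hf := isTameField_glassDrift pdata hα hσ x
  have := isProbabilityMeasure_posterior pdata hα hσ x
  have hfm := isPosteriorMean_glassDrift pdata hα hσ x
  have hν := integrable_id_posterior pdata hα hσ x
  have hlim := ae_exists_tendsto_flow_div hν hf hfm
  have hV : ∀ᵐ w ∂(stdGaussian (Pt d)), Tendsto (fun u : ℝ => u⁻¹ • flow hf 0 w u) atTop
      (𝓝 (limUnder atTop fun u : ℝ => u⁻¹ • flow hf 0 w u)) := by
    filter_upwards [hlim] with w hw using tendsto_nhds_limUnder hw
  refine ⟨_, ?_, map_lim_flow_div hν hf hfm hV⟩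
  filter_upwards [hV] with w hw
  refine ⟨_, isGlassTrajectory_one hS pdata ht x (isIntegralCurve_flow hf 0 w) hw, ?_, ?_⟩
  · simp [hS.α_zero, hS.σ_zero, flow_self]
  · simp

lemma hasLaw_diamondSample_one :
    HasLaw (diamondSample α σ pdata t 1 x) (ddpmKernel α σ pdata t 1 x)
      (stdGaussian (Pt d)) := by
  have hσ := hS.σ_pos (Ioo_subset_Ico_self ht)
  obtain ⟨V, hy, hVm, hV⟩ := ae_exists_isGlassTrajectory_one pdata hS ht x
  have hr : rStar α σ t 1 = 1 := rStar_one hS ht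
  have hae : diamondSample α σ pdata t 1 x =ᵐ[stdGaussian (Pt d)] V := by
    filter_upwards [hy] with w ⟨y, hy, hy0, hy1⟩
    have h1 := hy.diamondMap_eq hS pdata ht x le_rfl zero_le_one le_rfl
    rw [hy0, hy1] at h1
    rw [diamondSample, hr, h1, suffStat]
    simp only [hS.α_one, hS.σ_one]
    simp [smul_smul, (pow_pos hσ 2).ne']
  refine ⟨hVm.congr hae.symm, ?_⟩
  rw [Measure.map_congr hae, hV, ddpmKernel_one pdata hS]

end TerminalTime

end DiamondMap

theorem mainTheorem1 (d : ℕ) (α σ : ℝ → ℝ) (hασ : DiamondMap.IsScheduler α σ)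
    (pdata : Measure (DiamondMap.Pt d)) [IsProbabilityMeasure pdata]
    (t t' : ℝ) (ht : 0 < t) (htt' : t < t') (ht' : t' ≤ 1) (x : DiamondMap.Pt d) :
    -- the stopping time is well defined, and it corresponds to the outer time `t'`
    (DiamondMap.rStar α σ t t' ∈ Ioc 0 1 ∧
      DiamondMap.g α σ (DiamondMap.rStar α σ t t') =
        DiamondMap.g α σ t * DiamondMap.g α σ t' /
          (DiamondMap.g α σ t - DiamondMap.g α σ t') ∧
      DiamondMap.tStar α σ (DiamondMap.rStar α σ t t') t = t') ∧
    -- the diamond map transports points along all trajectories of the GLASS posterior ODE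
    (∀ s r : ℝ, 0 ≤ s → s ≤ r → r ≤ 1 → ∀ y : ℝ → DiamondMap.Pt d,
      DiamondMap.IsGlassTrajectory α σ pdata t x s r y →
        DiamondMap.diamondMap α σ pdata t x s r (y s) = y r) ∧
    -- trajectories up to the stopping time exist from every point if `t' < 1`,
    -- and from almost every point if `t' = 1`
    (t' < 1 → ∀ xbar₀ : DiamondMap.Pt d, ∃ y : ℝ → DiamondMap.Pt d,
      DiamondMap.IsGlassTrajectory α σ pdata t x 0 (DiamondMap.rStar α σ t t') y ∧
        y 0 = xbar₀) ∧
    (∀ᵐ xbar₀ ∂(stdGaussian (DiamondMap.Pt d)), ∃ y : ℝ → DiamondMap.Pt d,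
      DiamondMap.IsGlassTrajectory α σ pdata t x 0 (DiamondMap.rStar α σ t t') y ∧
        y 0 = xbar₀) ∧
    -- the sample obtained from Gaussian noise has exactly the DDPM transition law
    HasLaw (DiamondMap.diamondSample α σ pdata t t' x)
      (DiamondMap.ddpmKernel α σ pdata t t' x) (stdGaussian (DiamondMap.Pt d)) := by
  have ht1 : t ∈ Ioo (0 : ℝ) 1 := ⟨ht, htt'.trans_le ht'⟩
  refine ⟨⟨hασ.rStar_mem ht htt' ht', hασ.g_rStar ht htt' ht', hασ.tStar_rStar ht htt' ht'⟩,
    fun s r hs hsr hr y hy => hy.diamondMap_eq hασ pdata ht1 x hs hsr hr,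
    fun h => DiamondMap.exists_isGlassTrajectory pdata hασ ht htt' x h, ?_⟩
  rcases ht'.lt_or_eq with h | rfl
  · exact ⟨Filter.Eventually.of_forall
      (DiamondMap.exists_isGlassTrajectory pdata hασ ht htt' x h),
      DiamondMap.hasLaw_diamondSample_of_lt_one pdata hασ ht htt' x h⟩
  · refine ⟨?_, DiamondMap.hasLaw_diamondSample_one pdata hασ ht1 x⟩
    rw [DiamondMap.rStar_one hασ ht1]
    obtain ⟨V, hy, -⟩ := DiamondMap.ae_exists_isGlassTrajectory_one pdata hασ ht1 x
    filter_upwards [hy] with w ⟨y, hy, hy0, _⟩ using ⟨y, hy, hy0⟩
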